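/- Let $A$ be a finite alphabet and $k\ge 1$. \emph{Marble bimachines.} Fix a surjective morphism $\mu:A^*\to M$ onto a finite monoid. A $1$-marble bimachine $\mathcal M$ over $\mu$ is given by a map $\lambda:M\times A\times M\to\mathbb N$ and computes $f(w)=\sum_{i=1}^{|w|}\lambda_i(w)$, where $\lambda_i(w):=\lambda(\mu(w[1{:}i{-}1]),w[i],\mu(w[i{+}1{:}|w|]))$. For $k\ge 2$, a $k$-marble bimachine over $\mu$ is given by a map $\lambda$ from $M\times A\times M$ to the $(k-1)$-marble bimachines over $\mu$, and computes $f(w)=\sum_{i=1}^{|w|}h_i(w[1{:}i])$, where $h_i$ is the function computed by $\lambda_i(w)$. \emph{Productions.} For positions $i_1\le\dots\le i_k$ of $w$, let $\mathsf{prod}_{\mathcal M}^w(\{\!\{i_1,\dots,i_k\}\!\})$ be $\lambda_{i_1}(w)$ if $k=1$, and $\mathsf{prod}_{\mathcal M'}^{w[1:i_k]}(\{\!\{i_1,\dots,i_{k-1}\}\!\})$ with $\mathcal M'=\lambda_{i_k}(w)$ if $k\ge2$. A $k$-multicontext is a sequence $m_0[\![u_1]\!]m_1\cdots[\![u_k]\!]m_k$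 with $m_i\in M$, $u_i\in A^*$; multicontexts are concatenated by multiplying the two adjacent elements of $M$. Choose words $v_i$ with $\mu(v_i)=m_i$ and let $I_j$ be the set of positions of the factor $u_j$ in $w=v_0u_1v_1\cdots u_kv_k$; then $\mathsf{prod}_{\mathcal M}(m_0[\![u_1]\!]m_1\cdots[\![u_k]\!]m_k):=\sum_{i_1\in I_1,\dots,i_k\in I_k}\mathsf{prod}_{\mathcal M}^w(\{\!\{i_1,\dots,i_k\}\!\})$, which does not depend on the choice of the $v_i$. For $n,K\ge0$, an $(n,K)$-iterator is an $n$-multicontext of the form $m_0\prod_{i=1}^n e_i[\![u_i]\!]e_im_i$ where, for all $i$, $e_i=\mu(u_i)$ is idempotent and $|u_i|\le K$. \emph{Repetitiveness.} A function $f:A^*\to\mathbb N$ is $k$-repetitive if there is $\eta\ge1$ such that, for all $\alpha,\alpha_0,u_1,\alpha_1,\dots,u_k,\alpha_k,\beta\in A^*$ and every multiple $\omega\ge1$ of $\eta$, setting $W(X_1,\dots,X_k):=\alpha_0\prod_{i=1}^k u_i^{\omega X_i}\alpha_i$ and $w:=W(1,\dots,1)$, there is $F:\mathbb N^k\to\mathbb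 N$ such that for all $X_1,\dots,X_k,Y_1,\dots,Y_k\ge3$, $$f\big(\alpha\, w^{2\omega-1}\,W(X_1,\dots,X_k)\,w^{\omega-1}\,W(Y_1,\dots,Y_k)\,w^{\omega}\beta\big)=F(X_1+Y_1,\dots,X_k+Y_k).$$ \emph{Statement.} Let $f$ be a $k$-repetitive function computed by a $k$-marble bimachine $\mathcal M$ over $\mu$. Then $\mathcal M$ is $K$-permutable for every $K\ge0$, that is: for all $\ell,r\ge0$ and $x\ge1$ with $\ell+x+r=k$, every $(\ell,K)$-iterator $\mathcal L$, every $(r,K)$-iterator $\mathcal R$, every $(x,K)$-iterator $m_0\prod_{i=1}^x e_i[\![u_i]\!]e_im_i$ such that $e:=m_0\prod_{i=1}^x e_im_i$ is idempotent, and every permutation $\sigma$ of $\{1,\dots,x\}$, $$\mathsf{prod}_{\mathcal M}\Big(\mathcal L\; e\,m_0\Big(\prod_{i=1}^x e_i[\![u_i]\!]e_im_i\Big)e\;\mathcal R\Big)=\mathsf{prod}_{\mathcal M}\Big(\mathcal L\Big(\prod_{i=1}^x\mathsf{left}_{\sigma(i)}[\![u_{\sigma(i)}]\!]\mathsf{right}_{\sigma(i)}\Big)\mathcal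 R\Big),$$ where $\mathsf{left}_j:=e\prod_{i=1}^{j}m_{i-1}e_i$ and $\mathsf{right}_j:=\big(\prod_{i=j}^{x}e_im_i\big)e$. -/

import Mathlib

universe u v

/-- The table `λ` of a `k`-marble bimachine (`k ≥ 1`) over the alphabet `A` and the monoid `M`,
unfolded down to the outputs: for `k = 1` it is a map `M × A × M → ℕ`; for `k + 1 ≥ 2` it maps
`M × A × M` to the `k`-marble bimachines (over the same morphism) that compute the external
functions. -/
inductive MarbleTable (A : Type u) (M : Type v) : ℕ → Type (max u v)
  | one (lam : M → A → M → ℕ) : MarbleTable A M 1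
  | ext {k : ℕ} (lam : M → A → M → MarbleTable A M (k + 1)) : MarbleTable A M (k + 2)

/-- A `k`-marble bimachine: a surjective morphism `μ : A* → M` together with its table. -/
structure MarbleBimachine (A : Type u) (M : Type v) [Monoid M] (k : ℕ) where
  /-- the morphism, shared by all the submachines -/
  μ : FreeMonoid A →* M
  /-- every element of the monoid is the image of a word -/
  μ_surj : Function.Surjective μ
  /-- the output table -/
  table : MarbleTable A M k

/-- `λ(μ(w[1:i-1]), w[i], μ(w[i+1:|w|]))`, where `i` counts from `0`. -/
def tableAt {A : Type u} {M : Type v} [Monoid M] {B : Type*} (μ : FreeMonoid A →* M)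
    (lam : M → A → M → B) (w : FreeMonoid A) (i : Fin w.toList.length) : B :=
  lam (μ (FreeMonoid.ofList (w.toList.take i))) (w.toList.get i)
    (μ (FreeMonoid.ofList (w.toList.drop (i + 1))))

/-- The prefix `w[1:i]` of `w`, up to and including the position `i`, which counts from `0`. -/
def prefixThrough {A : Type u} (w : FreeMonoid A) (i : ℕ) : FreeMonoid A :=
  FreeMonoid.ofList (w.toList.take (i + 1))

namespace MarbleTable

variable {A : Type u} {M : Type v} [Monoid M]

/-- The computed function: the sum of the outputs over all positions if `k = 1`, and the sum over
all positions `i` of the external function selected at `i`, applied to `w[1:i]`, if `k ≥ 2`. -/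
def eval (μ : FreeMonoid A →* M) : {k : ℕ} → MarbleTable A M k → FreeMonoid A → ℕ
  | _, one lam, w => ∑ i : Fin w.toList.length, tableAt μ lam w i
  | _, ext lam, w => ∑ i : Fin w.toList.length, (tableAt μ lam w i).eval μ (prefixThrough w i)

/-- The production on the positions `i_k ≥ ⋯ ≥ i_1` of `w`, listed in this (non-increasing) order
and counted from `0`. It is `0` by convention if there are not exactly `k` positions of `w`. -/
def prodList (μ : FreeMonoid A →* M) :
    {k : ℕ} → MarbleTable A M k → FreeMonoid A → List ℕ → ℕ
  | _, one lam, w, [i] =>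
      if h : i < w.toList.length then tableAt μ lam w ⟨i, h⟩ else 0
  | _, ext lam, w, i :: is =>
      if h : i < w.toList.length then
        (tableAt μ lam w ⟨i, h⟩).prodList μ (prefixThrough w i) is
      else 0
  | _, _, _, _ => 0

end MarbleTable

/-- All the multisets `{{i_1, …, i_n}}` such that `i_j ∈ I_j` for every `j`. -/
def positionChoices : List (Finset ℕ) → Finset (Multiset ℕ)
  | [] => {0}
  | I :: Is => I.biUnion fun i => (positionChoices Is).image (fun s => i ::ₘ s)

/-- Sequences `m_0 ⟦u_1⟧ m_1 ⋯ ⟦u_n⟧ m_n` with `m_i` in a monoid `N` and `u_i` words on `A`. -/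
inductive Multicontext (A : Type u) (N : Type v) : Type (max u v)
  | ctx (m : N) : Multicontext A N
  | cons (m : N) (u : FreeMonoid A) (c : Multicontext A N) : Multicontext A N

namespace Multicontext

variable {A : Type u} {N : Type v}

/-- Multiply the first element `m_0` on the left by `n`. -/
def lmul [Mul N] (n : N) : Multicontext A N → Multicontext A N
  | ctx m => ctx (n * m)
  | cons m u c => cons (n * m) u c

/-- Concatenation: the last element of the first multicontext is multiplied with the first element
of the second one. -/
def append [Mul N] : Multicontext A N → Multicontext A N → Multicontext A N
  | ctx m, d => d.lmul m
  | cons m u c, d => cons m u (c.append d)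

instance [Mul N] : Mul (Multicontext A N) := ⟨append⟩

instance [One N] : One (Multicontext A N) := ⟨ctx 1⟩

theorem lmul_append [Semigroup N] (n : N) (c d : Multicontext A N) :
    (c.lmul n).append d = (c.append d).lmul n := by
  cases c <;> cases d <;> simp [lmul, append, mul_assoc]

theorem append_assoc [Semigroup N] (a b c : Multicontext A N) :
    (a.append b).append c = a.append (b.append c) := by
  induction a with
  | ctx m => exact lmul_append m b c
  | cons m u a ih => simp only [append, ih]

theorem append_one [Monoid N] (a : Multicontext A N) : a.append (ctx 1) = a := by
  induction a with
  | ctx m => simp [append, lmul]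
  | cons m u a ih => simp only [append, ih]

theorem one_append [Monoid N] (a : Multicontext A N) : (ctx 1 : Multicontext A N).append a = a := by
  cases a <;> simp [append, lmul]

instance [Monoid N] : Monoid (Multicontext A N) where
  mul_assoc := append_assoc
  one_mul := one_append
  mul_one := append_one

/-- The multicontext `⟦u⟧`. -/
def bracket [One N] (u : FreeMonoid A) : Multicontext A N := cons 1 u (ctx 1)

/-- Apply a map to all the elements `m_i`. -/
def map {N' : Type*} (g : N → N') : Multicontext A N → Multicontext A N'
  | ctx m => ctx (g m)
  | cons m u c => cons (g m) u (c.map g)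

/-- The word `v_0 u_1 v_1 ⋯ u_n v_n` underlying `v_0 ⟦u_1⟧ v_1 ⋯ ⟦u_n⟧ v_n`, for words `v_i`. -/
def word : Multicontext A (FreeMonoid A) → FreeMonoid A
  | ctx v => v
  | cons v u c => v * u * c.word

/-- The sets of positions of the factors `u_1, …, u_n` in the underlying word, counted from
`start`. -/
def factorPositions : ℕ → Multicontext A (FreeMonoid A) → List (Finset ℕ)
  | _, ctx _ => []
  | start, cons v u c =>
      Finset.Ico (start + v.length) (start + v.length + u.length) ::
        factorPositions (start + v.length + u.length) c

end Multicontext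

namespace MarbleBimachine

variable {A : Type u} {M : Type v} [Monoid M] {k : ℕ}

/-- The bimachine computes the function `f`. -/
def Computes (𝓜 : MarbleBimachine A M k) (f : FreeMonoid A → ℕ) : Prop :=
  ∀ w, f w = 𝓜.table.eval 𝓜.μ w

/-- The production on a multiset of positions of `w`, counted from `0`. -/
def prodPositions (𝓜 : MarbleBimachine A M k) (w : FreeMonoid A) (s : Multiset ℕ) : ℕ :=
  𝓜.table.prodList 𝓜.μ w (s.sort (· ≥ ·))

/-- The production on `{{I_1, …, I_k}}` for sets `I_j` of positions of `w`: the sum of the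
productions on the multisets `{{i_1, …, i_k}}` with `i_j ∈ I_j`. -/
def prodSets (𝓜 : MarbleBimachine A M k) (w : FreeMonoid A) (I : List (Finset ℕ)) : ℕ :=
  ∑ s ∈ positionChoices I, 𝓜.prodPositions w s

/-- The production on `v_0 ⟦u_1⟧ v_1 ⋯ ⟦u_k⟧ v_k`, for words `v_i`. -/
def prodWords (𝓜 : MarbleBimachine A M k) (c : Multicontext A (FreeMonoid A)) : ℕ :=
  𝓜.prodSets c.word (c.factorPositions 0)

/-- The production on `m_0 ⟦u_1⟧ m_1 ⋯ ⟦u_k⟧ m_k`, for `m_i ∈ M`: the production on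
`v_0 ⟦u_1⟧ v_1 ⋯ ⟦u_k⟧ v_k` for any words `v_i` such that `μ (v_i) = m_i`. The choice of the words
is irrelevant by `prodWords_eq_prod`. -/
noncomputable def prod (𝓜 : MarbleBimachine A M k) (c : Multicontext A M) : ℕ :=
  𝓜.prodWords (c.map (Function.surjInv 𝓜.μ_surj))

/-- The word `v_0 a_1 v_1 ⋯ a_n v` coded by the list `[(v_{n-1}, a_n), …, (v_0, a_1)]` and by `v`. -/
def markedWord : List (FreeMonoid A × A) → FreeMonoid A → FreeMonoid A
  | [], v => v
  | p :: S, v => markedWord S p.1 * FreeMonoid.of p.2 * v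

/-- The positions of `a_n, …, a_1` in the word coded as in `markedWord`. -/
def markedPositions : List (FreeMonoid A × A) → List ℕ
  | [] => []
  | p :: S => (markedWord S p.1).length :: markedPositions S

theorem markedWord_mul (S : List (FreeMonoid A × A)) (v v' : FreeMonoid A) :
    markedWord S (v * v') = markedWord S v * v' := by
  cases S <;> simp [markedWord, mul_assoc]

theorem map_markedWord_congr (μ : FreeMonoid A →* M) {S S' : List (FreeMonoid A × A)}
    (h : List.Forall₂ (fun p p' => μ p.1 = μ p'.1 ∧ p.2 = p'.2) S S') :
    ∀ {v v' : FreeMonoid A}, μ v = μ v' → μ (markedWord S v) = μ (markedWord S' v') := by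
  induction h with
  | nil => intro v v' hv; exact hv
  | cons hp _ ih =>
    intro v v' hv
    simp only [markedWord, map_mul, ih hp.1, hp.2, hv]

theorem lt_length_markedWord (p : FreeMonoid A × A) (S : List (FreeMonoid A × A))
    (v : FreeMonoid A) :
    (markedWord S p.1).length < (markedWord (p :: S) v).toList.length := by
  change _ < (markedWord (p :: S) v).length
  simp only [markedWord, FreeMonoid.length_mul, FreeMonoid.length_of]
  omega

theorem tableAt_markedWord {B : Type*} (μ : FreeMonoid A →* M) (lam : M → A → M → B)
    (p : FreeMonoid A × A) (S : List (FreeMonoid A × A)) (v : FreeMonoid A)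
    (h : (markedWord S p.1).length < (markedWord (p :: S) v).toList.length) :
    tableAt μ lam (markedWord (p :: S) v) ⟨_, h⟩ = lam (μ (markedWord S p.1)) p.2 (μ v) := by
  have e : (markedWord (p :: S) v).toList = (markedWord S p.1).toList ++ p.2 :: v.toList := by
    simp [markedWord, FreeMonoid.toList_mul, FreeMonoid.toList_of]
  have hl : (markedWord S p.1).length = (markedWord S p.1).toList.length := rfl
  have e1 : (markedWord (p :: S) v).toList.take (markedWord S p.1).length
      = (markedWord S p.1).toList := by
    rw [e, hl, List.take_left]
  have e2 : (markedWord (p :: S) v).toList.drop ((markedWord S p.1).length + 1) = v.toList := by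
    rw [e, hl, ← List.drop_drop, List.drop_left]; rfl
  have e3 : (markedWord (p :: S) v).toList.get ⟨(markedWord S p.1).length, h⟩ = p.2 := by
    simp [e, hl]
  simp only [tableAt, e1, e2, e3, FreeMonoid.ofList_toList]

theorem prefixThrough_markedWord (p : FreeMonoid A × A) (S : List (FreeMonoid A × A))
    (v : FreeMonoid A) :
    prefixThrough (markedWord (p :: S) v) (markedWord S p.1).length
      = markedWord S (p.1 * FreeMonoid.of p.2) := by
  have e : (markedWord (p :: S) v).toList
      = ((markedWord S p.1).toList ++ [p.2]) ++ v.toList := by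
    simp [markedWord, FreeMonoid.toList_mul, FreeMonoid.toList_of]
  have hl : (markedWord S p.1).length + 1 = ((markedWord S p.1).toList ++ [p.2]).length := by
    simp [FreeMonoid.length]
  rw [prefixThrough, e, hl, List.take_left, markedWord_mul]
  rfl

theorem prodList_markedWord_congr (μ : FreeMonoid A →* M) {k : ℕ} (t : MarbleTable A M k) :
    ∀ {S S' : List (FreeMonoid A × A)},
      List.Forall₂ (fun p p' => μ p.1 = μ p'.1 ∧ p.2 = p'.2) S S' →
      ∀ {v v' : FreeMonoid A}, μ v = μ v' →
      t.prodList μ (markedWord S v) (markedPositions S)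
        = t.prodList μ (markedWord S' v') (markedPositions S') := by
  induction t with
  | one lam =>
    intro S S' h v v' hv
    cases h with
    | nil => simp [markedPositions, MarbleTable.prodList]
    | @cons p p' S S' hp hS =>
      cases hS with
      | nil =>
        simp only [markedPositions, MarbleTable.prodList]
        rw [dif_pos (lt_length_markedWord p [] v), dif_pos (lt_length_markedWord p' [] v'),
          tableAt_markedWord, tableAt_markedWord]
        simp only [markedWord, hp.1, hp.2, hv]
      | cons _ _ => simp [markedPositions, MarbleTable.prodList]
  | ext lam ih =>
    intro S S' h v v' hv
    cases h with
    | nil => simp [markedPositions, MarbleTable.prodList]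
    | @cons p p' S S' hp hS =>
      simp only [markedPositions, MarbleTable.prodList]
      rw [dif_pos (lt_length_markedWord p S v), dif_pos (lt_length_markedWord p' S' v'),
        tableAt_markedWord, tableAt_markedWord, prefixThrough_markedWord,
        prefixThrough_markedWord, map_markedWord_congr μ hS hp.1, hp.2, hv]
      exact ih _ _ _ hS (by rw [map_mul, map_mul, hp.1])

theorem sortedGE_markedPositions (S : List (FreeMonoid A × A)) :
    (markedPositions S).Pairwise (· ≥ ·) := by
  have key : ∀ (S : List (FreeMonoid A × A)) (v : FreeMonoid A),
      ∀ i ∈ markedPositions S, i ≤ (markedWord S v).length := by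
    intro S
    induction S with
    | nil => simp [markedPositions]
    | cons p S ih =>
      intro v i hi
      simp only [markedPositions, List.mem_cons] at hi
      simp only [markedWord, FreeMonoid.length_mul]
      rcases hi with rfl | hi
      · omega
      · have := ih p.1 i hi
        omega
  induction S with
  | nil => simp [markedPositions]
  | cons p S ih => exact List.pairwise_cons.2 ⟨fun i hi => key S p.1 i hi, ih⟩

theorem le_of_mem_positionChoices (c : Multicontext A (FreeMonoid A)) :
    ∀ (start : ℕ), ∀ s ∈ positionChoices (c.factorPositions start), ∀ i ∈ s, start ≤ i := by
  induction c with
  | ctx v => simp [Multicontext.factorPositions, positionChoices]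
  | cons v u c ih =>
    intro start s hs i hi
    simp only [Multicontext.factorPositions, positionChoices, Finset.mem_biUnion,
      Finset.mem_image, Finset.mem_Ico] at hs
    obtain ⟨j, hj, s, hs, rfl⟩ := hs
    rcases Multiset.mem_cons.1 hi with rfl | hi
    · omega
    · have := ih _ s hs i hi
      omega

theorem sum_positionChoices_cons (start : ℕ) (v u : FreeMonoid A)
    (c : Multicontext A (FreeMonoid A)) (F : Multiset ℕ → ℕ) :
    ∑ s ∈ positionChoices ((Multicontext.cons v u c).factorPositions start), F s
      = ∑ j : Fin u.length, ∑ s ∈ positionChoices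
          (c.factorPositions (start + v.length + u.length)), F ((start + v.length + j) ::ₘ s) := by
  simp only [Multicontext.factorPositions, positionChoices]
  rw [Finset.sum_biUnion]
  · rw [Finset.sum_Ico_eq_sum_range, Nat.add_sub_cancel_left, Finset.sum_range]
    refine Finset.sum_congr rfl fun j _ => ?_
    rw [Finset.sum_image]
    intro s _ s' _ h
    exact (Multiset.cons_inj_right _).1 h
  · intro i hi j hj hij
    simp only [Finset.coe_Ico, Set.mem_Ico] at hi hj
    refine Finset.disjoint_left.2 fun s hs hs' => hij ?_
    obtain ⟨t, ht, rfl⟩ := Finset.mem_image.1 hs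
    obtain ⟨t', ht', h⟩ := Finset.mem_image.1 hs'
    have hm : i ∈ j ::ₘ t' := h ▸ Multiset.mem_cons_self i t
    rcases Multiset.mem_cons.1 hm with h' | h'
    · exact h'
    · have := le_of_mem_positionChoices c _ t' ht' i h'
      omega

theorem prodWords_congr_aux (𝓜 : MarbleBimachine A M k) (c : Multicontext A (FreeMonoid A)) :
    ∀ (c' : Multicontext A (FreeMonoid A)), c.map 𝓜.μ = c'.map 𝓜.μ →
      ∀ (S S' : List (FreeMonoid A × A)) (v v' : FreeMonoid A),
      List.Forall₂ (fun p p' => 𝓜.μ p.1 = 𝓜.μ p'.1 ∧ p.2 = p'.2) S S' → 𝓜.μ v = 𝓜.μ v' →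
      ∑ s ∈ positionChoices (c.factorPositions (markedWord S v).length),
          𝓜.prodPositions (markedWord S v * c.word) (s + markedPositions S)
        = ∑ s ∈ positionChoices (c'.factorPositions (markedWord S' v').length),
          𝓜.prodPositions (markedWord S' v' * c'.word) (s + markedPositions S') := by
  induction c with
  | ctx x =>
    intro c' hc S S' v v' hS hv
    cases c' with
    | cons _ _ _ => simp [Multicontext.map] at hc
    | ctx x' =>
      simp only [Multicontext.map, Multicontext.ctx.injEq] at hc
      simp only [Multicontext.factorPositions, positionChoices, Finset.sum_singleton, zero_add,
        Multicontext.word, prodPositions, Multiset.coe_sort, ← markedWord_mul]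
      rw [List.mergeSort_of_pairwise (by simpa using sortedGE_markedPositions S),
        List.mergeSort_of_pairwise (by simpa using sortedGE_markedPositions S')]
      exact prodList_markedWord_congr 𝓜.μ 𝓜.table hS (by rw [map_mul, map_mul, hv, hc])
  | cons x u c ih =>
    intro c' hc S S' v v' hS hv
    cases c' with
    | ctx _ => simp [Multicontext.map] at hc
    | cons x' u' c' =>
      simp only [Multicontext.map, Multicontext.cons.injEq] at hc
      obtain ⟨hx, rfl, hc⟩ := hc
      rw [sum_positionChoices_cons, sum_positionChoices_cons]
      refine Finset.sum_congr rfl fun j _ => ?_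
      have split : u = FreeMonoid.ofList (u.toList.take j) *
          (FreeMonoid.of (u.toList.get j) * FreeMonoid.ofList (u.toList.drop (j + 1))) := by
        apply FreeMonoid.toList.injective
        simp only [FreeMonoid.toList_mul, FreeMonoid.toList_of, FreeMonoid.toList_ofList,
          List.singleton_append]
        have hj : (j : ℕ) < u.toList.length := j.2
        have h := (List.take_append_drop (j : ℕ) u.toList).symm
        rw [← List.cons_getElem_drop_succ (h := hj)] at h
        exact h
      have hlen : (FreeMonoid.ofList (u.toList.take j)).length = j := by
        have : (j : ℕ) ≤ u.toList.length := j.2.le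
        simpa [FreeMonoid.length] using this
      have step : ∀ (S : List (FreeMonoid A × A)) (v x : FreeMonoid A)
          (c : Multicontext A (FreeMonoid A)),
          ∑ s ∈ positionChoices (c.factorPositions ((markedWord S v).length + x.length + u.length)),
            𝓜.prodPositions (markedWord S v * (Multicontext.cons x u c).word)
              (((markedWord S v).length + x.length + j) ::ₘ s + markedPositions S)
          = ∑ s ∈ positionChoices (c.factorPositions (markedWord
              ((v * x * FreeMonoid.ofList (u.toList.take j), u.toList.get j) :: S)
              (FreeMonoid.ofList (u.toList.drop (j + 1)))).length),
            𝓜.prodPositions (markedWord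
              ((v * x * FreeMonoid.ofList (u.toList.take j), u.toList.get j) :: S)
              (FreeMonoid.ofList (u.toList.drop (j + 1))) * c.word)
              (s + markedPositions
                ((v * x * FreeMonoid.ofList (u.toList.take j), u.toList.get j) :: S)) := by
        intro S v x c
        have hw : markedWord ((v * x * FreeMonoid.ofList (u.toList.take j), u.toList.get j) :: S)
            (FreeMonoid.ofList (u.toList.drop (j + 1))) = markedWord S v * x * u := by
          conv_rhs => rw [split]
          simp only [markedWord, markedWord_mul, mul_assoc]
        have hp : (markedWord S (v * x * FreeMonoid.ofList (u.toList.take j))).length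
            = (markedWord S v).length + x.length + j := by
          simp only [markedWord_mul, FreeMonoid.length_mul, hlen]
        have hl : (markedWord S v * x * u).length
            = (markedWord S v).length + x.length + u.length := by
          simp only [FreeMonoid.length_mul]
        rw [hw, hl]
        refine Finset.sum_congr rfl fun s _ => ?_
        rw [markedPositions, hp, ← Multiset.cons_coe, Multiset.cons_add, Multiset.add_cons,
          Multicontext.word]
        simp only [mul_assoc]
      rw [step, step]
      exact ih c' hc _ _ _ _
        (List.Forall₂.cons ⟨by simp only [map_mul, hv, hx], rfl⟩ hS) rfl

/-- The production on `v_0 ⟦u_1⟧ v_1 ⋯ ⟦u_k⟧ v_k` depends on the words `v_i` only through their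
images in the monoid. -/
theorem prodWords_eq_prod (𝓜 : MarbleBimachine A M k) (c : Multicontext A (FreeMonoid A)) :
    𝓜.prodWords c = 𝓜.prod (c.map 𝓜.μ) := by
  have hc : c.map 𝓜.μ = ((c.map 𝓜.μ).map (Function.surjInv 𝓜.μ_surj)).map 𝓜.μ := by
    induction c with
    | ctx v => simp [Multicontext.map, Function.surjInv_eq]
    | cons v u c ih => simp only [Multicontext.map, Function.surjInv_eq, ← ih]
  have := prodWords_congr_aux 𝓜 c _ hc [] [] 1 1 List.Forall₂.nil rfl
  simpa [markedWord, markedPositions, prod, prodWords, prodSets] using this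

end MarbleBimachine

/-- The multicontext `m_0 (∏_{i=1}^x e_i ⟦u_i⟧ e_i m_i)` with `e_i = μ(u_i)`. -/
def iteratorForm {A : Type u} {M : Type v} [Monoid M] (μ : FreeMonoid A →* M) {x : ℕ}
    (m : Fin (x + 1) → M) (u : Fin x → FreeMonoid A) : Multicontext A M :=
  .ctx (m 0) * (List.ofFn fun i : Fin x =>
    .ctx (μ (u i)) * .bracket (u i) * .ctx (μ (u i)) * .ctx (m i.succ)).prod

/-- The conditions on `u_1, …, u_x` for `m_0 (∏_{i=1}^x e_i ⟦u_i⟧ e_i m_i)`, with `e_i = μ(u_i)`, to be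
an `(x, K)`-iterator: every `e_i` is idempotent and `|u_i| ≤ K`. -/
def IsIteratorData {A : Type u} {M : Type v} [Monoid M] (μ : FreeMonoid A →* M) (K : ℕ) {x : ℕ}
    (u : Fin x → FreeMonoid A) : Prop :=
  ∀ i, IsIdempotentElem (μ (u i)) ∧ (u i).length ≤ K

/-- `(x, K)`-iterators. -/
def IsIterator {A : Type u} {M : Type v} [Monoid M] (μ : FreeMonoid A →* M) (x K : ℕ)
    (c : Multicontext A M) : Prop :=
  ∃ (m : Fin (x + 1) → M) (u : Fin x → FreeMonoid A),
    IsIteratorData μ K u ∧ c = iteratorForm μ m u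

/-- The element `m_0 (∏_{i=1}^x e_i m_i)` with `e_i = μ(u_i)`. -/
def iteratorValue {A : Type u} {M : Type v} [Monoid M] (μ : FreeMonoid A →* M) {x : ℕ}
    (m : Fin (x + 1) → M) (u : Fin x → FreeMonoid A) : M :=
  m 0 * (List.ofFn fun i : Fin x => μ (u i) * m i.succ).prod

/-- `left_j = e (∏_{i=1}^j m_{i-1} e_i)`. The index `j` counts from `0`. -/
def iteratorLeft {A : Type u} {M : Type v} [Monoid M] (μ : FreeMonoid A →* M) {x : ℕ}
    (m : Fin (x + 1) → M) (u : Fin x → FreeMonoid A) (j : Fin x) : M :=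
  iteratorValue μ m u *
    ((List.ofFn fun i : Fin x => m i.castSucc * μ (u i)).take (j + 1)).prod

/-- `right_j = (∏_{i=j}^x e_i m_i) e`. The index `j` counts from `0`. -/
def iteratorRight {A : Type u} {M : Type v} [Monoid M] (μ : FreeMonoid A →* M) {x : ℕ}
    (m : Fin (x + 1) → M) (u : Fin x → FreeMonoid A) (j : Fin x) : M :=
  ((List.ofFn fun i : Fin x => μ (u i) * m i.succ).drop j).prod * iteratorValue μ m u

/-- `K`-permutable `k`-marble bimachines. -/
def MarbleBimachine.IsPermutable {A : Type u} {M : Type v} [Monoid M] {k : ℕ}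
    (𝓜 : MarbleBimachine A M k) (K : ℕ) : Prop :=
  ∀ (l x r : ℕ), l + x + r = k → 1 ≤ x →
    ∀ (L R : Multicontext A M), IsIterator 𝓜.μ l K L → IsIterator 𝓜.μ r K R →
    ∀ (m : Fin (x + 1) → M) (u : Fin x → FreeMonoid A), IsIteratorData 𝓜.μ K u →
    IsIdempotentElem (iteratorValue 𝓜.μ m u) →
    ∀ σ : Equiv.Perm (Fin x),
      𝓜.prod (L * .ctx (iteratorValue 𝓜.μ m u) * iteratorForm 𝓜.μ m u *
          .ctx (iteratorValue 𝓜.μ m u) * R) =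
        𝓜.prod (L * (List.ofFn fun i : Fin x =>
          .ctx (iteratorLeft 𝓜.μ m u (σ i)) * .bracket (u (σ i)) *
            .ctx (iteratorRight 𝓜.μ m u (σ i))).prod * R)

/-- The word `α_0 ∏_{i=1}^k u_i^{ω X_i} α_i`. -/
def pumpedWord {A : Type u} {k : ℕ} (α : Fin (k + 1) → FreeMonoid A) (u : Fin k → FreeMonoid A)
    (ω : ℕ) (X : Fin k → ℕ) : FreeMonoid A :=
  α 0 * (List.ofFn fun i : Fin k => u i ^ (ω * X i) * α i.succ).prod

/-- `k`-repetitive functions. -/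
def IsRepetitive {A : Type u} (k : ℕ) (f : FreeMonoid A → ℕ) : Prop :=
  ∃ η : ℕ, 1 ≤ η ∧
    ∀ (a b : FreeMonoid A) (α : Fin (k + 1) → FreeMonoid A) (u : Fin k → FreeMonoid A) (ω : ℕ),
      1 ≤ ω → η ∣ ω →
      let W : (Fin k → ℕ) → FreeMonoid A := pumpedWord α u ω
      let w : FreeMonoid A := W (fun _ => 1)
      ∃ F : (Fin k → ℕ) → ℕ, ∀ X Y : Fin k → ℕ, (∀ i, 3 ≤ X i) → (∀ i, 3 ≤ Y i) →
        f (a * w ^ (2 * ω - 1) * W X * w ^ (ω - 1) * W Y * w ^ ω * b) = F (X + Y)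

/-! A production is a mixed difference of the computed function. Mark k slots in a word, and fill
each slot `i` with one of two words of equal value in the monoid. In the alternating sum of `f` over
the 2^k fillings, a choice of marbles that misses some slot cancels: that slot then acts only
through its value, which is the same for both fillings. With k marbles and k slots, exactly one
marble per slot remains, so only productions on the k slots survive (`Template.sum_eval_fillWord`).

If slot `i` holds a power of `b i`, whose value `e_i` is idempotent, and copies of `b i` stand on
both sides, the production is additive in the bracketed word. Hence `e_i ⟦b_i ^ n⟧ e_i` counts `n`
times `e_i ⟦b_i⟧ e_i`. The alternating sum for exponents `p + 3` and `q + 3` is therefore `(p - q) ^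
k` times the production of the iterated multicontext (`Template.sum_eval_pow`). For `p ≠ q`, this
production is determined by values of `f`.

Repetitiveness says that `f` sees only the sum of the exponents in two consecutive copies of a
pumped block. A slot can thus pass from one copy to the other without changing `f`, hence without
changing the production (`Template.prod_partialForm_cons`). Splitting off one slot at a time, in an
arbitrary order, gives every slot of the central iterator a block of its own
(`Template.prod_partialForm`). In such a block all the unbracketed factors collapse in the monoid to
`left_j` and `right_j` (`Template.partialForm_singleton`). Taking the order given by `σ` yields the
statement. -/

/-! ### Sums over the factorizations of a list. -/

section SplitSum

variable {α β : Type*}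

/-- The sum of `g p' a s'` over all the factorizations `s = p₁ ++ a :: s'`, with `p' = p ++ p₁`. -/
def splitSum (g : List α → α → List α → ℕ) : List α → List α → ℕ
  | _, [] => 0
  | p, a :: s => g p a s + splitSum g (p ++ [a]) s

theorem splitSum_append (g : List α → α → List α → ℕ) (p s₁ s₂ : List α) :
    splitSum g p (s₁ ++ s₂)
      = splitSum (fun p a s => g p a (s ++ s₂)) p s₁ + splitSum g (p ++ s₁) s₂ := by
  induction s₁ generalizing p with
  | nil => simp [splitSum]
  | cons a s₁ ih => simp [splitSum, ih, add_assoc]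

theorem splitSum_congr {g g' : List α → α → List α → ℕ} {s : List α} :
    ∀ {p p' : List α}, (∀ s₁ a s₂, s = s₁ ++ a :: s₂ → g (p ++ s₁) a s₂ = g' (p' ++ s₁) a s₂) →
      splitSum g p s = splitSum g' p' s := by
  induction s with
  | nil => intros; rfl
  | cons a s ih =>
    intro p p' h
    have h0 := h [] a s rfl
    simp only [List.append_nil] at h0
    simp only [splitSum, h0]
    congr 1
    refine ih fun s₁ b s₂ hs => ?_
    have := h (a :: s₁) b s₂ (by simp [hs])
    simpa using this

theorem splitSum_eq_zero {g : List α → α → List α → ℕ} {s : List α} {p : List α}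
    (h : ∀ s₁ a s₂, s = s₁ ++ a :: s₂ → g (p ++ s₁) a s₂ = 0) : splitSum g p s = 0 := by
  induction s generalizing p with
  | nil => rfl
  | cons a s ih =>
    have h0 := h [] a s rfl
    simp only [List.append_nil] at h0
    simp only [splitSum, h0, zero_add]
    refine ih fun s₁ b s₂ hs => ?_
    have := h (a :: s₁) b s₂ (by simp [hs])
    simpa using this

theorem splitSum_map (φ : α → β) (g : List β → β → List β → ℕ) (p s : List α) :
    splitSum g (p.map φ) (s.map φ)
      = splitSum (fun p a s => g (p.map φ) (φ a) (s.map φ)) p s := by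
  induction s generalizing p with
  | nil => rfl
  | cons a s ih => simp [splitSum, ← ih]

theorem splitSum_eq_sum (g : List α → α → List α → ℕ) (p s : List α) :
    splitSum g p s
      = ∑ i : Fin s.length, g (p ++ s.take i) (s.get i) (s.drop (i + 1)) := by
  induction s generalizing p with
  | nil => rfl
  | cons a s ih => simp [splitSum, ih, Fin.sum_univ_succ]

end SplitSum

/-! ### Evaluation with weights on labelled letters, and its expansion into productions. -/

section WeightedEvaluation

variable {A : Type u} {M : Type v} [Monoid M] {ι : Type*}

/-- The value in the monoid of a word with labelled letters. -/
def labelledValue (μ : FreeMonoid A →* M) (l : List (A × ι)) : M :=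
  μ (FreeMonoid.ofList (l.map Prod.fst))

theorem labelledValue_append (μ : FreeMonoid A →* M) (l l' : List (A × ι)) :
    labelledValue μ (l ++ l') = labelledValue μ l * labelledValue μ l' := by
  simp [labelledValue, FreeMonoid.ofList_append]

/-- The evaluation of a table on a word with labelled letters, where every choice of a position
labelled by `i` is counted with the weight `y i`. -/
def MarbleTable.weightedEval (μ : FreeMonoid A →* M) (y : ι → ℕ) :
    {k : ℕ} → MarbleTable A M k → List (A × ι) → ℕ
  | _, one lam, l =>
      splitSum (fun p a s => y a.2 * lam (labelledValue μ p) a.1 (labelledValue μ s)) [] l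
  | _, ext lam, l =>
      splitSum (fun p a s => y a.2 *
        (lam (labelledValue μ p) a.1 (labelledValue μ s)).weightedEval μ y (p ++ [a])) [] l

theorem MarbleTable.weightedEval_one (μ : FreeMonoid A →* M) {k : ℕ} (t : MarbleTable A M k) :
    ∀ l : List (A × ι), t.weightedEval μ (fun _ => 1) l
      = t.eval μ (FreeMonoid.ofList (l.map Prod.fst)) := by
  induction t with
  | one lam =>
    intro l
    have h := splitSum_map Prod.fst (fun (p : List A) a s =>
      lam (μ (FreeMonoid.ofList p)) a (μ (FreeMonoid.ofList s))) [] l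
    have h' := splitSum_eq_sum (fun (p : List A) a s =>
      lam (μ (FreeMonoid.ofList p)) a (μ (FreeMonoid.ofList s))) [] (l.map Prod.fst)
    simp only [weightedEval, one_mul, eval]
    exact h.symm.trans h'
  | ext lam ih =>
    intro l
    have h := splitSum_map Prod.fst (fun (p : List A) a s =>
      (lam (μ (FreeMonoid.ofList p)) a (μ (FreeMonoid.ofList s))).eval μ
        (FreeMonoid.ofList (p ++ [a]))) [] l
    have h' := splitSum_eq_sum (fun (p : List A) a s =>
      (lam (μ (FreeMonoid.ofList p)) a (μ (FreeMonoid.ofList s))).eval μ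
        (FreeMonoid.ofList (p ++ [a]))) [] (l.map Prod.fst)
    simp only [weightedEval, one_mul, eval, ih, List.map_append, List.map_cons, List.map_nil]
    refine (h.symm.trans h').trans (Finset.sum_congr rfl fun i _ => ?_)
    have hi : (i : ℕ) < (l.map Prod.fst).length := i.2
    simp only [tableAt, prefixThrough, List.nil_append, FreeMonoid.toList_ofList, List.get_eq_getElem]
    rw [List.take_append_getElem hi]

/-- Blocks of letters of weight `0` matter only through their values. -/
theorem MarbleTable.weightedEval_replace (μ : FreeMonoid A →* M) (y : ι → ℕ)
    {z z' : List (A × ι)} (hz : ∀ a ∈ z, y a.2 = 0) (hz' : ∀ a ∈ z', y a.2 = 0)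
    (h : labelledValue μ z = labelledValue μ z') {k : ℕ} (t : MarbleTable A M k) :
    ∀ p s : List (A × ι),
      t.weightedEval μ y (p ++ (z ++ s)) = t.weightedEval μ y (p ++ (z' ++ s)) := by
  induction t with
  | one lam =>
    intro p s
    simp only [weightedEval, splitSum_append, labelledValue_append, h]
    congr 2
    · rw [splitSum_eq_zero, splitSum_eq_zero]
      · rintro s₁ a s₂ rfl
        simp [hz' a (by simp)]
      · rintro s₁ a s₂ rfl
        simp [hz a (by simp)]
    · refine splitSum_congr fun s₁ a s₂ _ => ?_
      simp only [labelledValue_append, h]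
  | ext lam ih =>
    intro p s
    simp only [weightedEval, splitSum_append, labelledValue_append, h]
    congr 2
    · rw [splitSum_eq_zero, splitSum_eq_zero]
      · rintro s₁ a s₂ rfl
        simp [hz' a (by simp)]
      · rintro s₁ a s₂ rfl
        simp [hz a (by simp)]
    · refine splitSum_congr fun s₁ a s₂ _ => ?_
      -- A marble placed after the block leaves the block inside the prefix read by the inner table,
      -- where the induction hypothesis replaces it.
      have := ih (labelledValue μ (p ++ z' ++ s₁)) a.1 (labelledValue μ s₂) p (s₁ ++ [a])
      simp only [labelledValue_append, h, List.append_assoc, List.nil_append] at this ⊢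
      rw [this]

/-- The non-increasing lists of `k` natural numbers less than `n`. -/
def decreasingLists : ℕ → ℕ → Finset (List ℕ)
  | _, 0 => {[]}
  -- The bound `i + 1` allows the next marble to share position `i`: the inner table reads the
  -- prefix through `i`, inclusive.
  | n, k + 1 => (Finset.range n).biUnion fun i => (decreasingLists (i + 1) k).image (List.cons i)

theorem mem_decreasingLists {n k : ℕ} {l : List ℕ} :
    l ∈ decreasingLists n k ↔ l.length = k ∧ l.Pairwise (· ≥ ·) ∧ ∀ i ∈ l, i < n := by
  induction k generalizing n l with
  | zero =>
    simp only [decreasingLists, Finset.mem_singleton, List.length_eq_zero_iff]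
    constructor
    · rintro rfl; simp
    · exact fun h => h.1
  | succ k ih =>
    simp only [decreasingLists, Finset.mem_biUnion, Finset.mem_range, Finset.mem_image, ih]
    constructor
    · rintro ⟨i, hi, l, ⟨h1, h2, h3⟩, rfl⟩
      refine ⟨by simp [h1], List.pairwise_cons.2 ⟨fun j hj => Nat.lt_succ_iff.1 (h3 j hj), h2⟩, ?_⟩
      intro j hj
      rcases List.mem_cons.1 hj with rfl | hj
      · exact hi
      · have := h3 j hj
        omega
    · rintro ⟨h1, h2, h3⟩
      cases l with
      | nil => simp at h1
      | cons i l =>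
        rw [List.pairwise_cons] at h2
        exact ⟨i, h3 i (by simp), l, ⟨by simpa using h1, h2.2,
          fun j hj => Nat.lt_succ_iff.2 (h2.1 j hj)⟩, rfl⟩

theorem sum_decreasingLists_succ (n k : ℕ) (G : List ℕ → ℕ) :
    ∑ l ∈ decreasingLists n (k + 1), G l
      = ∑ i : Fin n, ∑ l ∈ decreasingLists (i + 1) k, G (i :: l) := by
  rw [decreasingLists, Finset.sum_biUnion, Finset.sum_range]
  · refine Finset.sum_congr rfl fun i _ => ?_
    rw [Finset.sum_image]
    intro l _ l' _ h
    simpa using h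
  · intro i _ j _ hij
    refine Finset.disjoint_left.2 fun s hs hs' => hij ?_
    obtain ⟨t, _, rfl⟩ := Finset.mem_image.1 hs
    obtain ⟨t', _, h⟩ := Finset.mem_image.1 hs'
    simp only [List.cons.injEq] at h
    exact h.1.symm

theorem tableAt_map_fst {B : Type*} (μ : FreeMonoid A →* M) (lam : M → A → M → B)
    (l : List (A × ι)) (i : ℕ) (h : i < l.length)
    (h' : i < (FreeMonoid.ofList (l.map Prod.fst)).toList.length) :
    tableAt μ lam (FreeMonoid.ofList (l.map Prod.fst)) ⟨i, h'⟩
      = lam (labelledValue μ (l.take i)) l[i].1 (labelledValue μ (l.drop (i + 1))) := by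
  simp [tableAt, labelledValue, List.map_take, List.map_drop]

theorem prefixThrough_map_fst (l : List (A × ι)) (i : ℕ) :
    prefixThrough (FreeMonoid.ofList (l.map Prod.fst)) i
      = FreeMonoid.ofList ((l.take (i + 1)).map Prod.fst) := by
  simp [prefixThrough, List.map_take]

/-- The weighted evaluation as a sum of productions. -/
theorem MarbleTable.weightedEval_eq_sum (μ : FreeMonoid A →* M) (y : ι → ℕ) (Y : ℕ → ℕ) {k : ℕ}
    (t : MarbleTable A M k) :
    ∀ l : List (A × ι), (∀ (i : ℕ) (h : i < l.length), Y i = y l[i].2) →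
      t.weightedEval μ y l = ∑ L ∈ decreasingLists l.length k,
        t.prodList μ (FreeMonoid.ofList (l.map Prod.fst)) L * (L.map Y).prod := by
  induction t with
  | one lam =>
    intro l hY
    rw [sum_decreasingLists_succ]
    simp only [weightedEval, splitSum_eq_sum]
    refine Finset.sum_congr rfl fun i _ => ?_
    have hi : (i : ℕ) < (FreeMonoid.ofList (l.map Prod.fst)).toList.length := by simp
    simp only [decreasingLists, Finset.sum_singleton, prodList, dif_pos hi]
    rw [tableAt_map_fst μ lam l i i.2 hi]
    simpa [hY] using mul_comm _ _
  | ext lam ih =>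
    intro l hY
    rw [sum_decreasingLists_succ]
    simp only [weightedEval, splitSum_eq_sum]
    refine Finset.sum_congr rfl fun i _ => ?_
    have hi : (i : ℕ) < (FreeMonoid.ofList (l.map Prod.fst)).toList.length := by simp
    simp only [prodList, dif_pos hi]
    rw [tableAt_map_fst μ lam l i i.2 hi]
    have hl : (l.take (i + 1)).length = i + 1 := by
      have := i.2
      simp only [List.length_take]
      omega
    simp only [List.nil_append, List.get_eq_getElem]
    rw [List.take_append_getElem i.2, ih _ _ _ (l.take (i + 1)), hl, Finset.mul_sum]
    · refine Finset.sum_congr rfl fun L _ => ?_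
      rw [prefixThrough_map_fst, List.map_cons, List.prod_cons, hY _ i.2]
      ring
    · intro j hj
      have hj' := hj
      rw [hl] at hj'
      rw [hY j (by omega), List.getElem_take]

end WeightedEvaluation

/-! ### Inclusion-exclusion for productions on sets of positions. -/

section PositionChoices

/-- Pigeonhole: a multiset with as many elements as there are pairwise disjoint sets, and which
meets all of them, has exactly one element in each. -/
theorem mem_positionChoices {Is : List (Finset ℕ)} (hI : Is.Pairwise Disjoint) {s : Multiset ℕ} :
    s ∈ positionChoices Is ↔ s.card = Is.length ∧ ∀ I ∈ Is, ∃ i ∈ s, i ∈ I := by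
  induction Is generalizing s with
  | nil => simp [positionChoices]
  | cons I Is ih =>
    rw [List.pairwise_cons] at hI
    simp only [positionChoices, Finset.mem_biUnion, Finset.mem_image, ih hI.2]
    constructor
    · rintro ⟨i, hi, s, ⟨hc, hs⟩, rfl⟩
      refine ⟨by simp [hc], fun J hJ => ?_⟩
      rcases List.mem_cons.1 hJ with rfl | hJ
      · exact ⟨i, by simp, hi⟩
      · obtain ⟨j, hj, hjJ⟩ := hs J hJ
        exact ⟨j, by simp [hj], hjJ⟩
    · rintro ⟨hc, hs⟩
      obtain ⟨i, his, hi⟩ := hs I (by simp)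
      obtain ⟨s, rfl⟩ := Multiset.exists_cons_of_mem his
      refine ⟨i, hi, s, ⟨by simpa using hc, fun J hJ => ?_⟩, rfl⟩
      obtain ⟨j, hj, hjJ⟩ := hs J (by simp [hJ])
      rcases Multiset.mem_cons.1 hj with rfl | hj
      · exact absurd hjJ (Finset.disjoint_left.1 (hI.1 J hJ) hi)
      · exact ⟨j, hj, hjJ⟩

theorem exists_mem_of_mem_positionChoices {Is : List (Finset ℕ)} {s : Multiset ℕ}
    (hs : s ∈ positionChoices Is) {i : ℕ} (hi : i ∈ s) : ∃ I ∈ Is, i ∈ I := by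
  induction Is generalizing s with
  | nil =>
    simp only [positionChoices, Finset.mem_singleton] at hs
    simp [hs] at hi
  | cons I Is ih =>
    simp only [positionChoices, Finset.mem_biUnion, Finset.mem_image] at hs
    obtain ⟨j, hj, s, hs, rfl⟩ := hs
    rcases Multiset.mem_cons.1 hi with rfl | hi
    · exact ⟨I, by simp, hj⟩
    · obtain ⟨J, hJ, hiJ⟩ := ih hs hi
      exact ⟨J, by simp [hJ], hiJ⟩

variable {ι : Type*} [DecidableEq ι]

/-- The weight that forbids the positions labelled by elements of `S`. -/
def avoidingWeight (S : Finset ι) (o : Option ι) : ℕ :=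
  o.elim 1 fun i => if i ∈ S then 0 else 1

theorem prod_avoidingWeight (S : Finset ι) (lab : ℕ → Option ι) (L : List ℕ) :
    (L.map fun i => avoidingWeight S (lab i)).prod
      = if ∀ j ∈ S, ∀ i ∈ L, lab i ≠ some j then 1 else 0 := by
  induction L with
  | nil => simp
  | cons a L ih =>
    rw [List.map_cons, List.prod_cons, ih]
    rcases h : lab a with _ | b
    · simp [avoidingWeight, h]
    · by_cases hb : b ∈ S
      · have hn : ¬ ∀ j ∈ S, ∀ i ∈ a :: L, lab i ≠ some j := fun hc => hc b hb a (by simp) h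
        rw [if_neg hn]
        simp [avoidingWeight, hb]
      · simp only [avoidingWeight, Option.elim_some, hb, if_false, one_mul]
        congr 1
        apply propext
        refine forall₂_congr fun j hj => ?_
        simp only [List.mem_cons, forall_eq_or_imp, h, ne_eq, Option.some.injEq]
        exact ⟨fun h' => ⟨fun e => hb (e ▸ hj), h'⟩, fun h' => h'.2⟩

/-- The subsets `S` with nonzero weight are exactly the subsets of the set of labels missed by `L`.
Their signs cancel unless that set is empty. -/
theorem sum_powerset_avoidingWeight (Λ : Finset ι) (lab : ℕ → Option ι) (L : List ℕ) :
    ∑ S ∈ Λ.powerset, (-1 : ℤ) ^ S.card * ((L.map fun i => avoidingWeight S (lab i)).prod : ℕ)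
      = if ∀ j ∈ Λ, ∃ i ∈ L, lab i = some j then 1 else 0 := by
  have hsub : (Λ.filter fun j => ∀ i ∈ L, lab i ≠ some j).powerset
      = Λ.powerset.filter fun S => ∀ j ∈ S, ∀ i ∈ L, lab i ≠ some j := by
    ext S
    simp only [Finset.mem_powerset, Finset.mem_filter, Finset.subset_iff]
    exact ⟨fun h => ⟨fun j hj => (h hj).1, fun j hj => (h hj).2⟩,
      fun h j hj => ⟨h.1 hj, h.2 j hj⟩⟩
  have h := Finset.sum_powerset_neg_one_pow_card
    (x := Λ.filter fun j => ∀ i ∈ L, lab i ≠ some j)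
  rw [hsub, Finset.sum_filter] at h
  simp only [prod_avoidingWeight, Nat.cast_ite, Nat.cast_one, Nat.cast_zero, mul_ite, mul_one,
    mul_zero]
  rw [h]
  congr 1
  simp [Finset.filter_eq_empty_iff]

/-- The production on sets of positions by inclusion-exclusion, when the sets are the fibres of
a labelling of the positions. -/
theorem MarbleBimachine.prodSets_eq_sum {A : Type u} {M : Type v} [Monoid M] {k : ℕ}
    (𝓜 : MarbleBimachine A M k) (w : FreeMonoid A) (lab : ℕ → Option ι) (Λ : List ι)
    (hΛ : Λ.Nodup) (hk : Λ.length = k) (Is : List (Finset ℕ))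
    (hI : List.Forall₂ (fun j I => ∀ i, i ∈ I ↔ lab i = some j) Λ Is)
    (hw : ∀ i j, lab i = some j → i < w.length) :
    (𝓜.prodSets w Is : ℤ) = ∑ S ∈ Λ.toFinset.powerset, (-1 : ℤ) ^ S.card *
      (∑ L ∈ decreasingLists w.length k, 𝓜.table.prodList 𝓜.μ w L *
        (L.map fun i => avoidingWeight S (lab i)).prod : ℕ) := by
  have hdisj : Is.Pairwise Disjoint := by
    clear hk
    induction hI with
    | nil => simp
    | @cons j I Λ Is hj hI ih =>
      rw [List.nodup_cons] at hΛ
      refine List.pairwise_cons.2 ⟨fun J hJ => ?_, ih hΛ.2⟩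
      obtain ⟨n, hn, rfl⟩ := List.getElem_of_mem hJ
      have hn' : n < Λ.length := by rw [hI.length_eq]; exact hn
      have := hI.get hn' hn
      simp only [List.get_eq_getElem] at this
      refine Finset.disjoint_left.2 fun i hi hi' => hΛ.1 ?_
      have e := ((hj i).1 hi).symm.trans ((this i).1 hi')
      rw [Option.some.injEq] at e
      rw [e]
      exact List.getElem_mem hn'
  have hmem : ∀ s : Multiset ℕ, (∀ I ∈ Is, ∃ i ∈ s, i ∈ I) ↔ ∀ j ∈ Λ, ∃ i ∈ s, lab i = some j := by
    intro s
    clear hk hdisj hΛ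
    induction hI with
    | nil => simp
    | cons hj hI ih => simp [ih, hj]
  have hswap : ∀ S : Finset ι, (-1 : ℤ) ^ S.card *
      (∑ L ∈ decreasingLists w.length k, 𝓜.table.prodList 𝓜.μ w L *
        (L.map fun i => avoidingWeight S (lab i)).prod : ℕ)
      = ∑ L ∈ decreasingLists w.length k, (𝓜.table.prodList 𝓜.μ w L : ℤ) *
        ((-1 : ℤ) ^ S.card * ((L.map fun i => avoidingWeight S (lab i)).prod : ℕ)) := by
    intro S
    rw [Nat.cast_sum, Finset.mul_sum]
    refine Finset.sum_congr rfl fun L _ => ?_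
    rw [Nat.cast_mul]
    ring
  simp only [hswap]
  rw [Finset.sum_comm]
  simp only [← Finset.mul_sum, sum_powerset_avoidingWeight, mul_ite, mul_one, mul_zero]
  rw [← Finset.sum_filter, prodSets, Nat.cast_sum]
  -- Sorting matches multisets of positions with non-increasing lists. As there are k labels and k
  -- positions, hitting every label is the same as choosing one position in each set.
  refine Finset.sum_nbij' (fun s => s.sort (· ≥ ·)) (fun L => (L : Multiset ℕ)) ?_ ?_ ?_ ?_ ?_
  · intro s hs
    have hs₀ := hs
    rw [mem_positionChoices hdisj, hmem] at hs
    rw [Finset.mem_filter, mem_decreasingLists]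
    refine ⟨⟨?_, s.pairwise_sort _, ?_⟩, ?_⟩
    · rw [Multiset.length_sort, hs.1, ← hI.length_eq, hk]
    · have hsub : ∀ I ∈ Is, ∀ i ∈ I, i < w.length := by
        clear hs hs₀ hmem hdisj hk hΛ
        induction hI with
        | nil => simp
        | @cons j I Λ Is hj hI ih =>
          intro J hJ i hi
          rcases List.mem_cons.1 hJ with rfl | hJ
          · exact hw i j ((hj i).1 hi)
          · exact ih J hJ i hi
      intro i hi
      obtain ⟨I, hI, hiI⟩ := exists_mem_of_mem_positionChoices hs₀ ((Multiset.mem_sort _).1 hi)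
      exact hsub I hI i hiI
    · intro j hj
      obtain ⟨i, hi, h⟩ := hs.2 j (List.mem_toFinset.1 hj)
      exact ⟨i, (Multiset.mem_sort _).2 hi, h⟩
  · intro L hL
    rw [Finset.mem_filter, mem_decreasingLists] at hL
    rw [mem_positionChoices hdisj, hmem]
    refine ⟨?_, fun j hj => ?_⟩
    · rw [Multiset.coe_card, hL.1.1, ← hI.length_eq, hk]
    · exact hL.2 j (List.mem_toFinset.2 hj)
  · intro s _
    exact Multiset.sort_eq _ _
  · intro L hL
    rw [Finset.mem_filter, mem_decreasingLists] at hL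
    rw [Multiset.coe_sort, List.mergeSort_of_pairwise]
    simpa using hL.1.2.1
  · intro s _
    rfl

end PositionChoices

/-! ### Compatibility of words, positions and morphisms with concatenation of multicontexts. -/

namespace Multicontext

variable {A : Type u} {N : Type v}

theorem ctx_mul [Mul N] (m : N) (c : Multicontext A N) : ctx m * c = c.lmul m := rfl

theorem cons_mul [Mul N] (m : N) (u : FreeMonoid A) (c d : Multicontext A N) :
    cons m u c * d = cons m u (c * d) := rfl

theorem ctx_mul_ctx [Mul N] (m n : N) : (ctx m : Multicontext A N) * ctx n = ctx (m * n) := rfl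

theorem bracket_mul [Monoid N] (u : FreeMonoid A) (c : Multicontext A N) :
    bracket u * c = cons 1 u c := by
  rw [bracket, cons_mul]
  exact congrArg _ (one_mul c)

theorem word_lmul (v : FreeMonoid A) (c : Multicontext A (FreeMonoid A)) :
    (c.lmul v).word = v * c.word := by
  cases c <;> simp [lmul, word, mul_assoc]

theorem word_mul (c d : Multicontext A (FreeMonoid A)) : (c * d).word = c.word * d.word := by
  induction c with
  | ctx v => exact word_lmul v d
  | cons v u c ih => rw [cons_mul, word, word, ih, mul_assoc, mul_assoc, mul_assoc]

theorem factorPositions_lmul (n : ℕ) (v : FreeMonoid A) (c : Multicontext A (FreeMonoid A)) :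
    (c.lmul v).factorPositions n = c.factorPositions (n + v.length) := by
  cases c <;> simp [lmul, factorPositions, add_assoc]

theorem map_mul {N' : Type*} [Monoid N] [Monoid N'] (g : N →* N') (c d : Multicontext A N) :
    (c * d).map g = c.map g * d.map g := by
  induction c with
  | ctx m => cases d <;> simp [ctx_mul, lmul, map]
  | cons m u c ih => simp only [cons_mul, map, ih]

theorem map_bracket {N' : Type*} [Monoid N] [Monoid N'] (g : N →* N') (u : FreeMonoid A) :
    (bracket u : Multicontext A N).map g = bracket u := by
  simp [bracket, map]

end Multicontext

/-! ### Templates, and the mixed differences of the computed function. -/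

/-- Words with slots labelled by `ι`. -/
abbrev Template (A : Type u) (ι : Type*) := FreeMonoid (FreeMonoid A ⊕ ι)

namespace Template

variable {A : Type u} {ι : Type*}

/-- The template that consists of a word. -/
def const (v : FreeMonoid A) : Template A ι := FreeMonoid.of (Sum.inl v)

/-- The template that consists of a slot. -/
def slot (i : ι) : Template A ι := FreeMonoid.of (Sum.inr i)

/-- The labels of the slots, from left to right. -/
def slots (τ : Template A ι) : List ι := τ.toList.filterMap Sum.getRight?

@[simp] theorem slots_one : slots (1 : Template A ι) = [] := rfl

@[simp] theorem slots_mul (τ τ' : Template A ι) : slots (τ * τ') = slots τ ++ slots τ' := by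
  simp [slots]

@[simp] theorem slots_const (v : FreeMonoid A) : slots (const v : Template A ι) = [] := rfl

@[simp] theorem slots_slot (i : ι) : slots (slot i : Template A ι) = [i] := rfl

/-- Extend to templates an interpretation of the words and of the slots. -/
def interpret {N : Type*} [Monoid N] (g : FreeMonoid A → N) (h : ι → N) : Template A ι →* N :=
  FreeMonoid.lift (Sum.elim g h)

@[simp] theorem interpret_const {N : Type*} [Monoid N] (g : FreeMonoid A → N) (h : ι → N)
    (v : FreeMonoid A) : interpret g h (const v) = g v := by
  simp [interpret, const]

@[simp] theorem interpret_slot {N : Type*} [Monoid N] (g : FreeMonoid A → N) (h : ι → N)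
    (i : ι) : interpret g h (slot i) = h i := by
  simp [interpret, slot]

theorem induction {P : Template A ι → Prop} (one : P 1)
    (const_mul : ∀ v τ, P τ → P (const v * τ)) (slot_mul : ∀ i τ, P τ → P (slot i * τ))
    (τ : Template A ι) : P τ := by
  induction τ using FreeMonoid.recOn with
  | one => exact one
  | of_mul x τ h =>
    rcases x with v | i
    · exact const_mul v τ h
    · exact slot_mul i τ h

/-- The word obtained by filling the slots. -/
def fillWord (U : ι → FreeMonoid A) : Template A ι →* FreeMonoid A := interpret id U

/-- The multicontext obtained by filling the slots with bracketed words. -/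
def fillContext (U : ι → FreeMonoid A) : Template A ι →* Multicontext A (FreeMonoid A) :=
  interpret .ctx fun i => .bracket (U i)

/-- The word obtained by filling the slots, where the letters that come from slots are labelled. -/
def fillLabels (U : ι → FreeMonoid A) : Template A ι →* FreeMonoid (A × Option ι) :=
  interpret (FreeMonoid.map fun a => (a, none)) fun i => FreeMonoid.map (fun a => (a, some i)) (U i)

theorem word_fillContext (U : ι → FreeMonoid A) (τ : Template A ι) :
    (fillContext U τ).word = fillWord U τ := by
  induction τ using Template.induction with
  | one => rfl
  | const_mul v τ ih =>
    simp [fillContext, fillWord, Multicontext.word_mul, Multicontext.word] at ih ⊢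
    rw [ih]
  | slot_mul i τ ih =>
    simp [fillContext, fillWord, Multicontext.word_mul, Multicontext.word,
      Multicontext.bracket] at ih ⊢
    rw [ih]

theorem map_fst_fillLabels (U : ι → FreeMonoid A) (τ : Template A ι) :
    FreeMonoid.ofList ((fillLabels U τ).toList.map Prod.fst) = fillWord U τ := by
  have key : ∀ (o : Option ι) (l : List A), (l.map fun a => (a, o)).map Prod.fst = l := by
    intro o l
    simp [Function.comp_def]
  induction τ using Template.induction with
  | one => rfl
  | const_mul v τ ih =>
    simp only [fillLabels, fillWord, _root_.map_mul, interpret_const, FreeMonoid.toList_mul,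
      List.map_append, FreeMonoid.ofList_append, FreeMonoid.toList_map, key] at ih ⊢
    rw [ih]
    rfl
  | slot_mul i τ ih =>
    simp only [fillLabels, fillWord, _root_.map_mul, interpret_slot, FreeMonoid.toList_mul,
      List.map_append, FreeMonoid.ofList_append, FreeMonoid.toList_map, key] at ih ⊢
    rw [ih]
    rfl

theorem mem_slots_of_mem_fillLabels (U : ι → FreeMonoid A) (τ : Template A ι) {i : ι} :
    ∀ a ∈ (fillLabels U τ).toList, a.2 = some i → i ∈ slots τ := by
  induction τ using Template.induction with
  | one => simp
  | const_mul v τ ih =>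
    intro a ha hi
    simp only [fillLabels, _root_.map_mul, interpret_const, FreeMonoid.toList_mul,
      List.mem_append, FreeMonoid.toList_map, List.mem_map] at ha
    rcases ha with ⟨b, _, rfl⟩ | ha
    · simp at hi
    · simpa using ih a ha hi
  | slot_mul j τ ih =>
    intro a ha hi
    simp only [fillLabels, _root_.map_mul, interpret_slot, FreeMonoid.toList_mul,
      List.mem_append, FreeMonoid.toList_map, List.mem_map] at ha
    rcases ha with ⟨b, _, rfl⟩ | ha
    · simp only [Option.some.injEq] at hi
      simp [hi]
    · simp [ih a ha hi]

/-- The lookup gives `none` both at unlabelled letters and beyond the end of the list, so the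
equivalence holds for every natural number `i`. -/
theorem mem_Ico_iff_label {P Q R : List (A × Option ι)} {j : ι}
    (hP : ∀ a ∈ P, a.2 ≠ some j) (hQ : ∀ a ∈ Q, a.2 = some j) (hR : ∀ a ∈ R, a.2 ≠ some j)
    (i : ℕ) :
    i ∈ Finset.Ico P.length (P.length + Q.length)
      ↔ (P ++ (Q ++ R))[i]?.bind Prod.snd = some j := by
  rw [Finset.mem_Ico]
  have key : ∀ l : List (A × Option ι), (∀ a ∈ l, a.2 ≠ some j) → ∀ n : ℕ,
      l[n]?.bind Prod.snd ≠ some j := by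
    intro l hl n h
    obtain ⟨a, ha, ha'⟩ := Option.bind_eq_some_iff.1 h
    exact hl a (List.mem_of_getElem? ha) ha'
  rcases lt_or_ge i P.length with h1 | h1
  · rw [List.getElem?_append_left h1]
    exact ⟨fun h => absurd h.1 (by omega), fun h => absurd h (key P hP i)⟩
  · rw [List.getElem?_append_right h1]
    rcases lt_or_ge (i - P.length) Q.length with h2 | h2
    · rw [List.getElem?_append_left h2, List.getElem?_eq_getElem h2, Option.bind_some,
        hQ _ (List.getElem_mem h2)]
      exact ⟨fun _ => rfl, fun _ => by omega⟩
    · rw [List.getElem?_append_right h2]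
      exact ⟨fun h => absurd h.2 (by omega), fun h => absurd h (key R hR _)⟩

/-- Since no label is repeated, the fibre of a label is the single interval occupied by its slot.
The list `P` carries the part of the word already read, so that the induction can shift positions.
-/
theorem forall₂_factorPositions (U : ι → FreeMonoid A) (τ : Template A ι) :
    ∀ P : List (A × Option ι), (slots τ).Nodup → (∀ a ∈ P, ∀ j ∈ slots τ, a.2 ≠ some j) →
      List.Forall₂ (fun j I => ∀ i, i ∈ I ↔
        (P ++ (fillLabels U τ).toList)[i]?.bind Prod.snd = some j)
        (slots τ) ((fillContext U τ).factorPositions P.length) := by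
  induction τ using Template.induction with
  | one => intro P _ _; exact List.Forall₂.nil
  | const_mul v τ ih =>
    intro P hnd hP
    have hl : (fillLabels U (const v * τ)).toList
        = v.toList.map (fun a => (a, none)) ++ (fillLabels U τ).toList := by
      simp [fillLabels, FreeMonoid.toList_map]
    have hc : (fillContext U (const v * τ)).factorPositions P.length
        = (fillContext U τ).factorPositions
          (P ++ v.toList.map (fun a => ((a, none) : A × Option ι))).length := by
      simp only [fillContext, _root_.map_mul, interpret_const, Multicontext.ctx_mul,
        Multicontext.factorPositions_lmul, List.length_append, List.length_map]
      rfl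
    rw [hl, hc, ← List.append_assoc]
    simp only [slots_mul, slots_const, List.nil_append] at hnd hP ⊢
    refine ih _ hnd fun a ha j hj => ?_
    rcases List.mem_append.1 ha with ha | ha
    · exact hP a ha j hj
    · obtain ⟨b, _, rfl⟩ := List.mem_map.1 ha
      simp
  | slot_mul i τ ih =>
    intro P hnd hP
    have hl : (fillLabels U (slot i * τ)).toList
        = (U i).toList.map (fun a => (a, some i)) ++ (fillLabels U τ).toList := by
      simp [fillLabels, FreeMonoid.toList_map]
    have hc : (fillContext U (slot i * τ)).factorPositions P.length
        = Finset.Ico P.length (P.length + ((U i).toList.map (fun a => (a, some i))).length) ::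
          (fillContext U τ).factorPositions
          (P ++ (U i).toList.map (fun a => (a, some i))).length := by
      simp only [fillContext, _root_.map_mul, interpret_slot, Multicontext.bracket_mul,
        Multicontext.factorPositions, List.length_append, List.length_map, FreeMonoid.length_one,
        add_zero]
      rfl
    rw [hl, hc]
    simp only [slots_mul, slots_slot, List.cons_append, List.nil_append, List.nodup_cons,
      List.mem_cons, forall_eq_or_imp] at hnd hP ⊢
    refine List.Forall₂.cons ?_ ?_
    · refine mem_Ico_iff_label (fun a ha => (hP a ha).1) ?_ ?_
      · intro a ha
        obtain ⟨b, _, rfl⟩ := List.mem_map.1 ha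
        rfl
      · exact fun a ha hai => hnd.1 (mem_slots_of_mem_fillLabels U τ a ha hai)
    · rw [← List.append_assoc]
      refine ih _ hnd.2 fun a ha j hj => ?_
      rcases List.mem_append.1 ha with ha | ha
      · exact (hP a ha).2 j hj
      · obtain ⟨b, _, rfl⟩ := List.mem_map.1 ha
        rintro h
        rw [Option.some.injEq] at h
        exact hnd.1 (h ▸ hj)

variable {M : Type v} [Monoid M] {k : ℕ} [DecidableEq ι]

/-- The bracketed factors are the fibres of the labelling, so inclusion-exclusion expresses their
production through evaluations that forbid the slots in `S`. -/
theorem prodWords_fillContext (𝓜 : MarbleBimachine A M k) (U : ι → FreeMonoid A)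
    (τ : Template A ι) (hnd : (slots τ).Nodup) (hk : (slots τ).length = k) :
    (𝓜.prodWords (fillContext U τ) : ℤ) = ∑ S ∈ (slots τ).toFinset.powerset, (-1 : ℤ) ^ S.card *
      (𝓜.table.weightedEval 𝓜.μ (avoidingWeight S) (fillLabels U τ).toList : ℕ) := by
  set l := (fillLabels U τ).toList with hl
  have hw : FreeMonoid.ofList (l.map Prod.fst) = fillWord U τ := map_fst_fillLabels U τ
  have hlen : l.length = (fillWord U τ).length := by
    rw [← hw]
    simp [FreeMonoid.length]
  have h := forall₂_factorPositions U τ [] hnd (by simp)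
  simp only [List.nil_append, List.length_nil, ← hl] at h
  rw [MarbleBimachine.prodWords, word_fillContext, 𝓜.prodSets_eq_sum (fillWord U τ)
    (fun i => l[i]?.bind Prod.snd) (slots τ) hnd hk _ h]
  · refine Finset.sum_congr rfl fun S _ => ?_
    rw [𝓜.table.weightedEval_eq_sum 𝓜.μ (avoidingWeight S)
      (fun i => avoidingWeight S (l[i]?.bind Prod.snd)) l, hw, hlen]
    intro i hi
    rw [List.getElem?_eq_getElem hi, Option.bind_some]
  · intro i j hij
    obtain ⟨a, ha, _⟩ := Option.bind_eq_some_iff.1 hij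
    rw [← hlen]
    exact (List.getElem?_eq_some_iff.1 ha).1

/-- No marble of nonzero weight falls in a slot of `S`, so such a slot matters only through its
value in the monoid. -/
theorem weightedEval_fillLabels_congr (μ : FreeMonoid A →* M) (t : MarbleTable A M k)
    (S : Finset ι) {U U' : ι → FreeMonoid A} (hS : ∀ i ∈ S, μ (U i) = μ (U' i))
    (hS' : ∀ i ∉ S, U i = U' i) (τ : Template A ι) :
    ∀ P : List (A × Option ι),
      t.weightedEval μ (avoidingWeight S) (P ++ (fillLabels U τ).toList)
        = t.weightedEval μ (avoidingWeight S) (P ++ (fillLabels U' τ).toList) := by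
  induction τ using Template.induction with
  | one => intro P; rfl
  | const_mul v τ ih =>
    intro P
    have hl : ∀ U : ι → FreeMonoid A, (fillLabels U (const v * τ)).toList
        = v.toList.map (fun a => (a, none)) ++ (fillLabels U τ).toList := by
      intro U
      simp [fillLabels, FreeMonoid.toList_map]
    rw [hl, hl, ← List.append_assoc, ih, List.append_assoc]
  | slot_mul i τ ih =>
    intro P
    have hl : ∀ U : ι → FreeMonoid A, (fillLabels U (slot i * τ)).toList
        = (U i).toList.map (fun a => (a, some i)) ++ (fillLabels U τ).toList := by
      intro U
      simp [fillLabels, FreeMonoid.toList_map]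
    rw [hl, hl]
    by_cases hi : i ∈ S
    · have hz : ∀ l : List A, ∀ a ∈ l.map (fun a => (a, some i)), avoidingWeight S a.2 = 0 := by
        intro l a ha
        obtain ⟨b, _, rfl⟩ := List.mem_map.1 ha
        simp [avoidingWeight, hi]
      have hv : ∀ w : FreeMonoid A,
          labelledValue μ (w.toList.map (fun a => (a, some i))) = μ w := by
        intro w
        simp [labelledValue, Function.comp_def]
      rw [t.weightedEval_replace μ _ (hz _) (hz (U' i).toList) (by rw [hv, hv, hS i hi]),
        ← List.append_assoc, ih, List.append_assoc]
    · rw [hS' i hi, ← List.append_assoc, ih, List.append_assoc]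

theorem eval_fillWord (μ : FreeMonoid A →* M) (t : MarbleTable A M k) (U : ι → FreeMonoid A)
    (τ : Template A ι) :
    t.eval μ (fillWord U τ) = t.weightedEval μ (avoidingWeight ∅) (fillLabels U τ).toList := by
  have h : avoidingWeight (∅ : Finset ι) = fun _ => 1 := by
    funext o
    cases o <;> simp [avoidingWeight]
  rw [h, t.weightedEval_one, map_fst_fillLabels]

/-- Pairing `T` with `insert i T` cancels the terms. -/
theorem sum_powerset_neg_one_pow_eq_zero {Λ : Finset ι} {i : ι} (hi : i ∈ Λ)
    (h : Finset ι → ℤ) (hh : ∀ T, i ∉ T → h (insert i T) = h T) :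
    ∑ T ∈ Λ.powerset, (-1 : ℤ) ^ T.card * h T = 0 := by
  rw [← Finset.insert_erase hi, Finset.sum_powerset_insert (Finset.notMem_erase i Λ),
    ← Finset.sum_add_distrib]
  refine Finset.sum_eq_zero fun T hT => ?_
  have hiT : i ∉ T := fun hc => Finset.notMem_erase i Λ (Finset.mem_powerset.1 hT hc)
  rw [hh T hiT, Finset.card_insert_of_notMem hiT]
  ring

/-- The iterated differences of the computed function, when every slot is filled by two words
with the same value, are those of the productions. -/
theorem sum_eval_fillWord (𝓜 : MarbleBimachine A M k) (U₀ U₁ : ι → FreeMonoid A)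
    (hU : ∀ i, 𝓜.μ (U₀ i) = 𝓜.μ (U₁ i))
    (τ : Template A ι) (hnd : (slots τ).Nodup) (hk : (slots τ).length = k) :
    ∑ T ∈ (slots τ).toFinset.powerset, (-1 : ℤ) ^ T.card *
        (𝓜.table.eval 𝓜.μ (fillWord (fun i => if i ∈ T then U₁ i else U₀ i) τ) : ℤ)
      = ∑ T ∈ (slots τ).toFinset.powerset, (-1 : ℤ) ^ T.card *
        (𝓜.prodWords (fillContext (fun i => if i ∈ T then U₁ i else U₀ i) τ) : ℤ) := by
  simp only [prodWords_fillContext 𝓜 _ τ hnd hk, Finset.mul_sum]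
  -- After exchanging the sums, the term of a nonempty `S` does not depend on the filling of the
  -- slots in `S`, so its alternating sum over `T` vanishes. The term `S = ∅` forbids nothing and is
  -- the computed function.
  refine Eq.symm (Finset.sum_comm.trans ((Finset.sum_eq_single ∅ ?_ ?_).trans ?_))
  · intro S hS hne
    obtain ⟨i, hi⟩ := Finset.nonempty_iff_ne_empty.2 hne
    have hiΛ := Finset.mem_powerset.1 hS hi
    have := sum_powerset_neg_one_pow_eq_zero hiΛ
      (fun T => (-1 : ℤ) ^ S.card * (𝓜.table.weightedEval 𝓜.μ (avoidingWeight S)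
        (fillLabels (fun i => if i ∈ T then U₁ i else U₀ i) τ).toList : ℕ)) ?_
    · exact this
    · intro T hT
      have hc := weightedEval_fillLabels_congr 𝓜.μ 𝓜.table S
        (U := fun j => if j ∈ insert i T then U₁ j else U₀ j)
        (U' := fun j => if j ∈ T then U₁ j else U₀ j) ?_ ?_ τ []
      · simp only [List.nil_append] at hc
        simp only [hc]
      · intro j _
        split_ifs <;> simp [hU]
      · intro j hj
        have hji : j ≠ i := fun e => hj (e ▸ hi)
        simp [hji]
  · intro h
    exact absurd (Finset.empty_mem_powerset _) h
  · refine Finset.sum_congr rfl fun T _ => ?_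
    rw [eval_fillWord]
    simp

end Template

/-! ### Additivity of productions in the bracketed words. -/

namespace MarbleBimachine

variable {A : Type u} {M : Type v} [Monoid M] {k : ℕ}

/-- The position chosen in `U * V` lies either in `U` or in `V`. -/
theorem sum_positionChoices_bracket_mul (U V : FreeMonoid A) (d : Multicontext A (FreeMonoid A))
    (F : Multiset ℕ → ℕ) (c : Multicontext A (FreeMonoid A)) : ∀ n : ℕ,
    ∑ s ∈ positionChoices ((c * (.bracket (U * V) * d)).factorPositions n), F s
      = ∑ s ∈ positionChoices ((c * (.bracket U * (.ctx V * d))).factorPositions n), F s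
        + ∑ s ∈ positionChoices ((c * (.ctx U * (.bracket V * d))).factorPositions n), F s := by
  induction c generalizing F with
  | ctx v =>
    intro n
    simp only [Multicontext.ctx_mul, Multicontext.factorPositions_lmul, Multicontext.bracket_mul,
      sum_positionChoices_cons, FreeMonoid.length_one, add_zero]
    generalize n + v.length = n
    rw [Fin.sum_univ_eq_sum_range (fun j => ∑ s ∈ positionChoices
        (d.factorPositions (n + (U * V).length)), F ((n + j) ::ₘ s)),
      Fin.sum_univ_eq_sum_range (fun j => ∑ s ∈ positionChoices
        (d.factorPositions (n + U.length + V.length)), F ((n + j) ::ₘ s)),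
      Fin.sum_univ_eq_sum_range (fun j => ∑ s ∈ positionChoices
        (d.factorPositions (n + U.length + V.length)), F ((n + U.length + j) ::ₘ s)),
      FreeMonoid.length_mul, Finset.sum_range_add]
    simp only [add_assoc]
  | cons v u c ih =>
    intro n
    simp only [Multicontext.cons_mul, sum_positionChoices_cons, ← Finset.sum_add_distrib]
    exact Finset.sum_congr rfl fun j _ => ih _ _

theorem exists_map_eq (𝓜 : MarbleBimachine A M k) (C : Multicontext A M) :
    ∃ c : Multicontext A (FreeMonoid A), c.map 𝓜.μ = C := by
  induction C with
  | ctx m =>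
    obtain ⟨v, rfl⟩ := 𝓜.μ_surj m
    exact ⟨.ctx v, rfl⟩
  | cons m u C ih =>
    obtain ⟨v, rfl⟩ := 𝓜.μ_surj m
    obtain ⟨c, rfl⟩ := ih
    exact ⟨.cons v u c, rfl⟩

/-- Productions are additive in every bracketed word. -/
theorem prod_bracket_mul (𝓜 : MarbleBimachine A M k) (C D : Multicontext A M)
    (U V : FreeMonoid A) :
    𝓜.prod (C * (.bracket (U * V) * D))
      = 𝓜.prod (C * (.bracket U * (.ctx (𝓜.μ V) * D)))
        + 𝓜.prod (C * (.ctx (𝓜.μ U) * (.bracket V * D))) := by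
  obtain ⟨c, rfl⟩ := 𝓜.exists_map_eq C
  obtain ⟨d, rfl⟩ := 𝓜.exists_map_eq D
  have hctx : ∀ w : FreeMonoid A,
      (.ctx (𝓜.μ w) : Multicontext A M) = (Multicontext.ctx w).map 𝓜.μ := fun _ => rfl
  simp only [hctx, ← Multicontext.map_bracket 𝓜.μ, ← Multicontext.map_mul, ← prodWords_eq_prod,
    prodWords, prodSets]
  rw [sum_positionChoices_bracket_mul]
  simp [Multicontext.word_mul, Multicontext.bracket, Multicontext.word, mul_assoc]

/-- Additivity for `1 * 1 = 1` says that this production is twice itself. -/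
theorem prod_bracket_one (𝓜 : MarbleBimachine A M k) (C D : Multicontext A M) :
    𝓜.prod (C * (.bracket 1 * D)) = 0 := by
  have h := 𝓜.prod_bracket_mul C D 1 1
  have h1 : (.ctx (𝓜.μ 1) : Multicontext A M) = 1 := by rw [map_one]; rfl
  rw [h1, one_mul, one_mul, one_mul] at h
  omega

/-- By additivity the chosen position lies in one of the `n` copies of `u`; the values of the other
copies are absorbed by the idempotents on both sides. -/
theorem prod_bracket_pow (𝓜 : MarbleBimachine A M k) (C D : Multicontext A M)
    {u : FreeMonoid A} (hu : IsIdempotentElem (𝓜.μ u)) (n : ℕ) :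
    𝓜.prod (C * (.ctx (𝓜.μ u) * (.bracket (u ^ n) * (.ctx (𝓜.μ u) * D))))
      = n * 𝓜.prod (C * (.ctx (𝓜.μ u) * (.bracket u * (.ctx (𝓜.μ u) * D)))) := by
  induction n with
  | zero => rw [pow_zero, ← mul_assoc, prod_bracket_one, zero_mul]
  | succ n ih =>
    have h1 : (.ctx (𝓜.μ u) : Multicontext A M) * .ctx (𝓜.μ u) = .ctx (𝓜.μ u) := by
      rw [Multicontext.ctx_mul_ctx, hu.eq]
    have h2 : (.ctx (𝓜.μ u) : Multicontext A M) * .ctx (𝓜.μ (u ^ n)) = .ctx (𝓜.μ u) := by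
      rw [Multicontext.ctx_mul_ctx, map_pow, ← pow_succ', hu.pow_succ_eq]
    rw [pow_succ, ← mul_assoc C, prod_bracket_mul]
    rw [← mul_assoc (Multicontext.ctx (𝓜.μ u)) (.ctx (𝓜.μ u)) D, h1, mul_assoc C, ih, mul_assoc C,
      ← mul_assoc (Multicontext.ctx (𝓜.μ u)) (.ctx (𝓜.μ (u ^ n))), h2]
    ring

end MarbleBimachine

/-! ### Mixed differences when the slots hold powers of words with idempotent values. -/

namespace Template

variable {A : Type u} {M : Type v} [Monoid M] {ι : Type*} {k : ℕ}

/-- The multicontext where every slot is replaced by `e ⟦u⟧ e`, with `e = μ(u)`. -/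
def iterContext (μ : FreeMonoid A →* M) (b : ι → FreeMonoid A) :
    Template A ι →* Multicontext A M :=
  interpret (fun v => .ctx (μ v)) fun i => .ctx (μ (b i)) * .bracket (b i) * .ctx (μ (b i))

/-- The multicontext where every slot is replaced by `e ⟦u ^ n⟧ e`, with `e = μ(u)`. -/
def powContext (μ : FreeMonoid A →* M) (b : ι → FreeMonoid A) (n : ι → ℕ) :
    Template A ι →* Multicontext A M :=
  interpret (fun v => .ctx (μ v)) fun i =>
    .ctx (μ (b i)) * .bracket (b i ^ n i) * .ctx (μ (b i))

/-- Each slot contributes its exponent as a factor; the context `C` holds the slots already treated.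
-/
theorem prod_powContext (𝓜 : MarbleBimachine A M k) {b : ι → FreeMonoid A}
    (hb : ∀ i, IsIdempotentElem (𝓜.μ (b i))) (n : ι → ℕ) (τ : Template A ι) :
    ∀ C : Multicontext A M, 𝓜.prod (C * powContext 𝓜.μ b n τ)
      = ((slots τ).map n).prod * 𝓜.prod (C * iterContext 𝓜.μ b τ) := by
  induction τ using Template.induction with
  | one => simp
  | const_mul v τ ih =>
    intro C
    have := ih (C * .ctx (𝓜.μ v))
    simpa [powContext, iterContext, mul_assoc] using this
  | slot_mul i τ ih =>
    intro C
    have h := ih (C * (.ctx (𝓜.μ (b i)) * (.bracket (b i ^ n i) * .ctx (𝓜.μ (b i)))))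
    have h' := 𝓜.prod_bracket_pow C (iterContext 𝓜.μ b τ) (hb i) (n i)
    simp only [powContext, iterContext, map_mul, interpret_slot, mul_assoc, slots_mul, slots_slot,
      List.cons_append, List.nil_append, List.map_cons, List.prod_cons] at h h' ⊢
    rw [h, h']
    ring

/-- The template where a copy of `b i` is inserted on both sides of every slot `i`. -/
def guard (b : ι → FreeMonoid A) : Template A ι →* Template A ι :=
  interpret const fun i => const (b i) * slot i * const (b i)

theorem slots_guard (b : ι → FreeMonoid A) (τ : Template A ι) : slots (guard b τ) = slots τ := by
  induction τ using Template.induction with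
  | one => rfl
  | const_mul v τ ih => simpa [guard] using ih
  | slot_mul i τ ih => simpa [guard] using ih

theorem fillWord_guard (b U : ι → FreeMonoid A) (τ : Template A ι) :
    fillWord U (guard b τ) = fillWord (fun i => b i * U i * b i) τ := by
  induction τ using Template.induction with
  | one => rfl
  | const_mul v τ ih => simpa [guard, fillWord] using ih
  | slot_mul i τ ih => simpa [guard, fillWord] using ih

theorem map_fillContext_guard (μ : FreeMonoid A →* M) (b : ι → FreeMonoid A) (n : ι → ℕ)
    (τ : Template A ι) :
    (fillContext (fun i => b i ^ n i) (guard b τ)).map μ = powContext μ b n τ := by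
  have hctx : ∀ w : FreeMonoid A,
      (Multicontext.ctx w : Multicontext A _).map μ = .ctx (μ w) := fun _ => rfl
  induction τ using Template.induction with
  | one => exact (hctx 1).trans (by rw [map_one]; rfl)
  | const_mul v τ ih =>
    simp only [guard, fillContext, powContext, map_mul, interpret_const, Multicontext.map_mul,
      hctx] at ih ⊢
    rw [ih]
  | slot_mul i τ ih =>
    simp only [guard, fillContext, powContext, map_mul, interpret_const, interpret_slot,
      Multicontext.map_mul, hctx, Multicontext.map_bracket] at ih ⊢
    rw [ih]

variable [DecidableEq ι]

/-- The iterated differences of the computed function, when every slot `i` is filled by powers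
of `b i`. -/
theorem sum_eval_pow (𝓜 : MarbleBimachine A M k) {b : ι → FreeMonoid A}
    (hb : ∀ i, IsIdempotentElem (𝓜.μ (b i))) (p q : ℕ)
    (τ : Template A ι) (hnd : (slots τ).Nodup) (hk : (slots τ).length = k) :
    ∑ T ∈ (slots τ).toFinset.powerset, (-1 : ℤ) ^ T.card *
        (𝓜.table.eval 𝓜.μ (fillWord (fun i => b i ^ if i ∈ T then q + 3 else p + 3) τ) : ℤ)
      = ((p : ℤ) - q) ^ k * (𝓜.prod (iterContext 𝓜.μ b τ) : ℤ) := by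
  -- The exponents are positive, so both fillings have the same idempotent value. The two guards
  -- raise the exponents in the word to `p + 3` and `q + 3`, while the brackets contain only `p + 1`
  -- and `q + 1` copies.
  have h := sum_eval_fillWord 𝓜 (fun i => b i ^ (p + 1)) (fun i => b i ^ (q + 1))
    (fun i => by rw [map_pow, map_pow, (hb i).pow_succ_eq, (hb i).pow_succ_eq]) (guard b τ)
    (by rwa [slots_guard]) (by rwa [slots_guard])
  simp only [slots_guard, fillWord_guard] at h
  have hfill : ∀ T : Finset ι,
      (fun i => b i * (if i ∈ T then b i ^ (q + 1) else b i ^ (p + 1)) * b i)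
        = fun i => b i ^ if i ∈ T then q + 3 else p + 3 := by
    intro T
    funext i
    split_ifs
    · rw [← pow_succ', ← pow_succ]
    · rw [← pow_succ', ← pow_succ]
  have hpow : ∀ T : Finset ι,
      (fun i => if i ∈ T then b i ^ (q + 1) else b i ^ (p + 1))
        = fun i => b i ^ if i ∈ T then q + 1 else p + 1 := by
    intro T
    funext i
    split_ifs <;> rfl
  simp only [hfill, hpow] at h
  rw [h]
  have hT : ∀ T ∈ (slots τ).toFinset.powerset, (-1 : ℤ) ^ T.card *
      (𝓜.prodWords (fillContext (fun i => b i ^ if i ∈ T then q + 1 else p + 1) (guard b τ)) : ℤ)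
      = ((-((q : ℤ) + 1)) ^ T.card * ((p : ℤ) + 1) ^ ((slots τ).toFinset.card - T.card)) *
        (𝓜.prod (iterContext 𝓜.μ b τ) : ℤ) := by
    intro T hT
    have hp := prod_powContext 𝓜 hb (fun i => if i ∈ T then q + 1 else p + 1) τ 1
    rw [one_mul, one_mul] at hp
    rw [𝓜.prodWords_eq_prod, map_fillContext_guard 𝓜.μ b (fun i => if i ∈ T then q + 1 else p + 1),
      hp, ← List.prod_toFinset _ hnd, Finset.prod_ite, Finset.prod_const, Finset.prod_const,
      Finset.filter_mem_eq_inter, Finset.inter_eq_right.2 (Finset.mem_powerset.1 hT),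
      Finset.filter_notMem_eq_sdiff, Finset.card_sdiff_of_subset (Finset.mem_powerset.1 hT),
      neg_pow ((q : ℤ) + 1)]
    push_cast
    ring
  -- Binomial theorem over subsets: the sum is `((p + 1) - (q + 1)) ^ k`.
  rw [Finset.sum_congr rfl hT, ← Finset.sum_mul, Finset.sum_pow_mul_eq_add_pow,
    List.toFinset_card_of_nodup hnd, hk]
  congr 2
  ring

end Template

/-! ### Repetitiveness passes to fewer pumped factors. -/

section Repetitive

variable {A : Type u}

theorem pumpedWord_snoc {k : ℕ} (α : Fin (k + 1) → FreeMonoid A) (u : Fin k → FreeMonoid A)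
    (ω : ℕ) (X : Fin (k + 1) → ℕ) :
    pumpedWord (Fin.snoc α 1 : Fin (k + 2) → FreeMonoid A)
        (Fin.snoc u 1 : Fin (k + 1) → FreeMonoid A) ω X
      = pumpedWord α u ω fun i => X i.castSucc := by
  have h0 : (Fin.snoc α 1 : Fin (k + 2) → FreeMonoid A) 0 = α 0 := by
    rw [← Fin.castSucc_zero, Fin.snoc_castSucc (α := fun _ => FreeMonoid A)]
  have h1 : ∀ i : Fin k, (Fin.snoc α 1 : Fin (k + 2) → FreeMonoid A) i.castSucc.succ
      = α i.succ := by
    intro i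
    rw [Fin.succ_castSucc, Fin.snoc_castSucc (α := fun _ => FreeMonoid A)]
  have h2 : (Fin.snoc α 1 : Fin (k + 2) → FreeMonoid A) (Fin.last k).succ = 1 := by
    rw [Fin.succ_last, Fin.snoc_last (α := fun _ => FreeMonoid A)]
  simp only [pumpedWord, List.ofFn_succ', List.concat_eq_append, List.prod_append,
    List.prod_singleton, h0, h1, h2, Fin.snoc_castSucc (α := fun _ => FreeMonoid A),
    Fin.snoc_last (α := fun _ => FreeMonoid A), one_pow, mul_one]

/-- The missing pumped factor is taken to be the empty word. This is needed because the central
iterator may have fewer than k brackets. -/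
theorem IsRepetitive.of_succ {k : ℕ} {f : FreeMonoid A → ℕ} (h : IsRepetitive (k + 1) f) :
    IsRepetitive k f := by
  obtain ⟨η, hη, h⟩ := h
  refine ⟨η, hη, fun a b α u ω hω hd => ?_⟩
  obtain ⟨F, hF⟩ := h a b (Fin.snoc α 1 : Fin (k + 2) → FreeMonoid A)
    (Fin.snoc u 1 : Fin (k + 1) → FreeMonoid A) ω hω hd
  -- The dummy exponents are `3`, the least allowed value, in both blocks; hence the sum `6`.
  refine ⟨fun Z => F (Fin.snoc Z 6 : Fin (k + 1) → ℕ), fun X Y hX hY => ?_⟩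
  have hs : ∀ X : Fin k → ℕ, (∀ i, 3 ≤ X i) →
      ∀ i, 3 ≤ (Fin.snoc X 3 : Fin (k + 1) → ℕ) i := by
    intro X hX i
    induction i using Fin.lastCases with
    | last => rw [Fin.snoc_last (α := fun _ => ℕ)]
    | cast i => rw [Fin.snoc_castSucc (α := fun _ => ℕ)]; exact hX i
  have h' := hF _ _ (hs X hX) (hs Y hY)
  have hadd : (Fin.snoc X 3 : Fin (k + 1) → ℕ) + (Fin.snoc Y 3 : Fin (k + 1) → ℕ)
      = (Fin.snoc (X + Y) 6 : Fin (k + 1) → ℕ) := by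
    funext i
    rw [Pi.add_apply]
    induction i using Fin.lastCases with
    | last => simp only [Fin.snoc_last (α := fun _ => ℕ)]
    | cast i => simp only [Fin.snoc_castSucc (α := fun _ => ℕ), Pi.add_apply]
  simp only [pumpedWord_snoc, Fin.snoc_castSucc (α := fun _ => ℕ), hadd] at h'
  exact h'

theorem IsRepetitive.of_le {k x : ℕ} (hx : x ≤ k) {f : FreeMonoid A → ℕ}
    (h : IsRepetitive k f) : IsRepetitive x f := by
  induction k, hx using Nat.le_induction with
  | base => exact h
  | succ k _ ih => exact ih h.of_succ

end Repetitive

/-! ### Central blocks in which only some of the pumped factors are slots. -/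

namespace Multicontext

variable {A : Type u} {M : Type v} [Monoid M]

/-- Elements of the monoid as multicontexts without brackets. -/
def ctxHom : M →* Multicontext A M where
  toFun := ctx
  map_one' := rfl
  map_mul' _ _ := rfl

end Multicontext

namespace Template

variable {A : Type u} {M : Type v} [Monoid M] {ι : Type*} {x : ℕ}

/-- The template `α_0 ∏ s_i α_i`, where `s_i` is a slot if `i ∈ T`, and the word `u_i ^ N`
otherwise. -/
def center (α : Fin (x + 1) → FreeMonoid A) (b : ι → FreeMonoid A) (g : Fin x → ι) (N : ℕ)
    (T : Finset (Fin x)) : Template A ι :=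
  const (α 0) * (List.ofFn fun i : Fin x =>
    (if i ∈ T then slot (g i) else const (b (g i) ^ N)) * const (α i.succ)).prod

theorem slots_list_prod (l : List (Template A ι)) : slots l.prod = l.flatMap slots := by
  induction l with
  | nil => rfl
  | cons τ l ih => simp [ih]

theorem flatMap_ite_singleton {β γ : Type*} (p : β → Prop) [DecidablePred p] (g : β → γ)
    (l : List β) :
    (l.flatMap fun i => if p i then [g i] else []) = (l.filter fun i => p i).map g := by
  induction l with
  | nil => rfl
  | cons a l ih =>
    by_cases h : p a <;> simp [h, ih]

theorem slots_center (α : Fin (x + 1) → FreeMonoid A) (b : ι → FreeMonoid A) (g : Fin x → ι)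
    (N : ℕ) (T : Finset (Fin x)) :
    slots (center α b g N T) = ((List.finRange x).filter fun i => i ∈ T).map g := by
  rw [center, slots_mul, slots_list_prod, slots_const, List.nil_append, List.ofFn_eq_map,
    List.flatMap_map, ← flatMap_ite_singleton]
  congr 1
  funext i
  split_ifs <;> simp

/-- Slots occur in the order of the block, whatever the order of `js`; only the set of labels
matters for the mixed differences. -/
theorem slots_center_perm (α : Fin (x + 1) → FreeMonoid A) (b : ι → FreeMonoid A)
    (g : Fin x → ι) (N : ℕ) {js : List (Fin x)} (hjs : js.Nodup) :
    (slots (center α b g N js.toFinset)).Perm (js.map g) := by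
  rw [slots_center]
  refine List.Perm.map g ((List.perm_ext_iff_of_nodup ((List.nodup_finRange x).filter _) hjs).2 ?_)
  simp

/-- The choice `N = ω * 3` makes a factor that is not a slot look like one with exponent `3`, so
that filling always gives a pumped word. -/
theorem fillWord_center (α : Fin (x + 1) → FreeMonoid A) (b : ι → FreeMonoid A) (g : Fin x → ι)
    (ω : ℕ) (T : Finset (Fin x)) (X : ι → ℕ) :
    fillWord (fun i => b i ^ (ω * X i)) (center α b g (ω * 3) T)
      = pumpedWord α (fun i => b (g i)) ω fun i => if i ∈ T then X (g i) else 3 := by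
  simp only [fillWord, center, map_mul, interpret_const, id, map_list_prod, List.map_ofFn,
    pumpedWord]
  congr 3
  funext i
  simp only [Function.comp_apply, map_mul, interpret_const, id]
  split_ifs <;> simp

/-- The multicontext `m_0 ∏ s_i m_i`, where `s_i = e_i ⟦u_i⟧ e_i` if `i ∈ T`, and `s_i = e_i`
otherwise, with `e_i = μ(u_i)`. -/
def partialForm (μ : FreeMonoid A →* M) (m : Fin (x + 1) → M) (u : Fin x → FreeMonoid A)
    (T : Finset (Fin x)) : Multicontext A M :=
  .ctx (m 0) * (List.ofFn fun i : Fin x =>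
    (if i ∈ T then .ctx (μ (u i)) * .bracket (u i) * .ctx (μ (u i)) else .ctx (μ (u i))) *
      .ctx (m i.succ)).prod

theorem partialForm_univ (μ : FreeMonoid A →* M) (m : Fin (x + 1) → M)
    (u : Fin x → FreeMonoid A) : partialForm μ m u Finset.univ = iteratorForm μ m u := by
  simp [partialForm, iteratorForm]

theorem iterContext_center (μ : FreeMonoid A →* M) (α : Fin (x + 1) → FreeMonoid A)
    (b : ι → FreeMonoid A) (g : Fin x → ι) {N : ℕ} (hN : N ≠ 0)
    (hb : ∀ i, IsIdempotentElem (μ (b i))) (T : Finset (Fin x)) :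
    iterContext μ b (center α b g N T)
      = partialForm μ (fun i => μ (α i)) (fun i => b (g i)) T := by
  obtain ⟨N, rfl⟩ := Nat.exists_eq_succ_of_ne_zero hN
  simp only [iterContext, center, map_mul, interpret_const, map_list_prod, List.map_ofFn,
    partialForm]
  congr 3
  funext i
  simp only [Function.comp_apply, map_mul, interpret_const]
  split_ifs
  · simp
  · simp [(hb (g i)).pow_succ_eq]

/-- Regrouping `m_0 (e_1 m_1) ⋯ (e_j m_j)` as `(m_0 e_1) ⋯ (m_{j-1} e_j) m_j` reconciles the
grouping used in `iteratorLeft` with that of `iteratorValue`. -/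
theorem mul_prod_take (m : Fin (x + 1) → M) (e : Fin x → M) (j : ℕ) (hj : j < x + 1) :
    m 0 * ((List.ofFn fun i : Fin x => e i * m i.succ).take j).prod
      = ((List.ofFn fun i : Fin x => m i.castSucc * e i).take j).prod * m ⟨j, hj⟩ := by
  induction j with
  | zero => simp
  | succ j ih =>
    have hj' : j < x := by omega
    have h1 : j < (List.ofFn fun i : Fin x => e i * m i.succ).length := by simpa using hj'
    have h2 : j < (List.ofFn fun i : Fin x => m i.castSucc * e i).length := by simpa using hj'
    rw [← List.take_append_getElem h1, ← List.take_append_getElem h2, List.prod_append,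
      List.prod_append, ← mul_assoc, ih (by omega)]
    simp [mul_assoc]

/-- With a single bracket, all the factors before it multiply to one element of the monoid, and so
do all the factors after it. -/
theorem partialForm_singleton (μ : FreeMonoid A →* M) (m : Fin (x + 1) → M)
    (u : Fin x → FreeMonoid A) (j : Fin x) :
    .ctx (iteratorValue μ m u) * partialForm μ m u {j} * .ctx (iteratorValue μ m u)
      = .ctx (iteratorLeft μ m u j) * .bracket (u j) * .ctx (iteratorRight μ m u j) := by
  have hctx : ∀ n : M, (.ctx n : Multicontext A M) = Multicontext.ctxHom n := fun _ => rfl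
  set G : List M := List.ofFn fun i : Fin x => μ (u i) * m i.succ with hG
  set H : List (Multicontext A M) := List.ofFn fun i : Fin x =>
    (if i ∈ ({j} : Finset (Fin x)) then .ctx (μ (u i)) * .bracket (u i) * .ctx (μ (u i))
      else .ctx (μ (u i))) * .ctx (m i.succ) with hH
  have hjG : (j : ℕ) < G.length := by simp [hG]
  have hjH : (j : ℕ) < H.length := by simp [hH]
  have hGH : ∀ (i : ℕ) (h : i < G.length) (h' : i < H.length), i ≠ j →
      H[i] = Multicontext.ctxHom G[i] := by
    intro i h h' hij
    have : ¬ (⟨i, by simpa [hG] using h⟩ : Fin x) = j := fun e => hij (by rw [← e])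
    simp only [hG, hH, List.getElem_ofFn, Finset.mem_singleton, this, if_false, hctx, map_mul]
  have hlen : G.length = H.length := by simp [hG, hH]
  have htake : (H.take j).prod = Multicontext.ctxHom (G.take j).prod := by
    rw [map_list_prod]
    congr 1
    refine List.ext_getElem (by simp [hlen]) fun i h1 h2 => ?_
    simp only [List.length_take, List.length_map, lt_inf_iff] at h1 h2
    rw [List.getElem_take, List.getElem_map, List.getElem_take,
      hGH i (by omega) (by omega) (by omega)]
  have hdrop : (H.drop (j + 1)).prod = Multicontext.ctxHom (G.drop (j + 1)).prod := by
    rw [map_list_prod]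
    congr 1
    refine List.ext_getElem (by simp [hlen]) fun i h1 h2 => ?_
    simp only [List.length_drop, List.length_map] at h1 h2
    rw [List.getElem_drop, List.getElem_map, List.getElem_drop,
      hGH _ (by omega) (by omega) (by omega)]
  have hHj : H[(j : ℕ)] = .ctx (μ (u j)) * .bracket (u j) * .ctx (μ (u j)) * .ctx (m j.succ) := by
    simp [hH]
  have hGj : G[(j : ℕ)] = μ (u j) * m j.succ := by simp [hG]
  have hprod : H.prod = Multicontext.ctxHom (G.take j).prod *
      (.ctx (μ (u j)) * .bracket (u j) * .ctx (μ (u j)) * .ctx (m j.succ)) *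
      Multicontext.ctxHom (G.drop (j + 1)).prod := by
    rw [← htake, ← hdrop, ← hHj, mul_assoc, ← List.prod_cons, ← List.drop_eq_getElem_cons hjH,
      ← List.prod_append, List.take_append_drop]
  have hleft : iteratorLeft μ m u j
      = iteratorValue μ m u * m 0 * (G.take j).prod * μ (u j) := by
    have h2 : (j : ℕ) < (List.ofFn fun i : Fin x => m i.castSucc * μ (u i)).length := by simp
    have h := mul_prod_take m (fun i => μ (u i)) j (by omega)
    rw [iteratorLeft, ← List.take_append_getElem h2, List.prod_append, mul_assoc _ (m 0), hG, h]
    simp [mul_assoc]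
    rfl
  have hright : iteratorRight μ m u j
      = μ (u j) * m j.succ * (G.drop (j + 1)).prod * iteratorValue μ m u := by
    rw [iteratorRight, ← hG, List.drop_eq_getElem_cons hjG, List.prod_cons, hGj]
  rw [partialForm, ← hH, hprod, hleft, hright]
  simp only [hctx, map_mul, mul_assoc]

end Template

/-! ### Moving slots between consecutive copies of the central block. -/

namespace Template

variable {A : Type u} {M : Type v} [Monoid M] {ι : Type*} {x : ℕ}

theorem map_pumpedWord (μ : FreeMonoid A →* M) (α : Fin (x + 1) → FreeMonoid A)
    (u : Fin x → FreeMonoid A) (hu : ∀ i, IsIdempotentElem (μ (u i))) {ω : ℕ} (hω : ω ≠ 0)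
    {X : Fin x → ℕ} (hX : ∀ i, X i ≠ 0) :
    μ (pumpedWord α u ω X) = iteratorValue μ (fun i => μ (α i)) u := by
  simp only [pumpedWord, iteratorValue, map_mul, map_list_prod, List.map_ofFn]
  congr 3
  funext i
  obtain ⟨n, hn⟩ := Nat.exists_eq_succ_of_ne_zero (mul_ne_zero hω (hX i))
  simp only [Function.comp_apply, map_mul, map_pow, hn, Nat.succ_eq_add_one, (hu i).pow_succ_eq]

variable [DecidableEq ι] {k : ℕ}

/-- A slot of the central part can be moved to a central part of its own. -/
theorem prod_partialForm_cons (𝓜 : MarbleBimachine A M k) {f : FreeMonoid A → ℕ}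
    (hf : 𝓜.Computes f) (hrep : IsRepetitive x f) {b : ι → FreeMonoid A}
    (hb : ∀ i, IsIdempotentElem (𝓜.μ (b i))) (α : Fin (x + 1) → FreeMonoid A) (g : Fin x → ι)
    {e : M} (he : e = iteratorValue 𝓜.μ (fun i => 𝓜.μ (α i)) fun i => b (g i))
    (hidem : IsIdempotentElem e) (τL τR : Template A ι) {j : Fin x} {js : List (Fin x)}
    (hjs : (j :: js).Nodup) (hnd : (slots τL ++ (j :: js).map g ++ slots τR).Nodup)
    (hk : (slots τL ++ (j :: js).map g ++ slots τR).length = k) :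
    𝓜.prod (iterContext 𝓜.μ b τL *
        (.ctx e * partialForm 𝓜.μ (fun i => 𝓜.μ (α i)) (fun i => b (g i)) (j :: js).toFinset *
          .ctx e) * iterContext 𝓜.μ b τR)
      = 𝓜.prod (iterContext 𝓜.μ b τL *
        (.ctx e * partialForm 𝓜.μ (fun i => 𝓜.μ (α i)) (fun i => b (g i)) {j} * .ctx e) *
        (.ctx e * partialForm 𝓜.μ (fun i => 𝓜.μ (α i)) (fun i => b (g i)) js.toFinset * .ctx e) *
        iterContext 𝓜.μ b τR) := by
  obtain ⟨η, hη, hrep⟩ := hrep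
  -- Doubling gives `ω ≥ 2`, so that `w ^ (ω - 1)` is a nonempty power and has value `e`.
  set ω := 2 * η with hω
  have hω0 : ω ≠ 0 := by omega
  set W := pumpedWord α (fun i => b (g i)) ω with hW
  set w := W fun _ => 1 with hw
  have hval : ∀ X : Fin x → ℕ, (∀ i, X i ≠ 0) → 𝓜.μ (W X) = e := fun X hX => by
    rw [he]
    exact map_pumpedWord 𝓜.μ α _ (fun i => hb (g i)) hω0 hX
  have hpow : ∀ n, n ≠ 0 → 𝓜.μ (w ^ n) = e := fun n hn => by
    obtain ⟨n, rfl⟩ := Nat.exists_eq_succ_of_ne_zero hn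
    rw [map_pow, hval _ (fun _ => one_ne_zero), Nat.succ_eq_add_one, hidem.pow_succ_eq]
  set C := center α b g (ω * 3) with hC
  -- Both templates have the shape of the repetitiveness condition. In `τ₁` all the slots are in the
  -- first block and the second is frozen at exponent `3`; in `τ₂` only `j` is in the first block,
  -- the others being in the second.
  set τ₁ : Template A ι := τL * (const (w ^ (2 * ω - 1)) * C (j :: js).toFinset *
    const (w ^ (ω - 1) * W (fun _ => 3) * w ^ ω)) * τR with hτ₁
  set τ₂ : Template A ι := τL * (const (w ^ (2 * ω - 1)) * C [j].toFinset *
    const (w ^ (ω - 1)) * C js.toFinset * const (w ^ ω)) * τR with hτ₂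
  have hjs' := List.nodup_cons.1 hjs
  have hp₁ : (slots τ₁).Perm (slots τL ++ (j :: js).map g ++ slots τR) := by
    simp only [hτ₁, slots_mul, slots_const, List.nil_append, List.append_nil]
    exact ((slots_center_perm α b g _ hjs).append_left _).append_right _
  have hp₂ : (slots τ₂).Perm (slots τL ++ (j :: js).map g ++ slots τR) := by
    simp only [hτ₂, slots_mul, slots_const, List.nil_append, List.append_nil]
    refine List.Perm.append_right _ (List.Perm.append_left _ ?_)
    exact (slots_center_perm α b g _ (List.nodup_singleton j)).append
      (slots_center_perm α b g _ hjs'.2)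
  have hslots : (slots τ₁).toFinset = (slots τ₂).toFinset :=
    List.toFinset_eq_of_perm _ _ (hp₁.trans hp₂.symm)
  -- With the shift by `3`, the two exponents of a slot are `ω * 3` and `ω * 4`.
  have h₁ := sum_eval_pow 𝓜 hb (ω * 3 - 3) (ω * 4 - 3) τ₁ (hp₁.nodup_iff.2 hnd)
    (hp₁.length_eq.trans hk)
  have h₂ := sum_eval_pow 𝓜 hb (ω * 3 - 3) (ω * 4 - 3) τ₂ (hp₂.nodup_iff.2 hnd)
    (hp₂.length_eq.trans hk)
  have hexp : ∀ T : Finset ι, (fun i => b i ^ if i ∈ T then ω * 4 - 3 + 3 else ω * 3 - 3 + 3)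
      = fun i => b i ^ (ω * if i ∈ T then 4 else 3) := by
    intro T
    funext i
    have e3 : ω * 3 - 3 + 3 = ω * 3 := by omega
    have e4 : ω * 4 - 3 + 3 = ω * 4 := by omega
    rw [e3, e4]
    split_ifs <;> rfl
  have hword : ∀ T : Finset ι,
      𝓜.table.eval 𝓜.μ (fillWord (fun i => b i ^ (ω * if i ∈ T then 4 else 3)) τ₁)
        = 𝓜.table.eval 𝓜.μ (fillWord (fun i => b i ^ (ω * if i ∈ T then 4 else 3)) τ₂) := by
    intro T
    set U : ι → FreeMonoid A := fun i => b i ^ (ω * if i ∈ T then 4 else 3) with hU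
    have hfC : ∀ S, fillWord U (C S)
        = W fun i => if i ∈ S then (if g i ∈ T then 4 else 3) else 3 :=
      fun S => fillWord_center α b g ω S fun i => if i ∈ T then 4 else 3
    have hconst : ∀ v : FreeMonoid A, fillWord U (const v) = v := fun v => by simp [fillWord]
    -- The slots of `τL` and `τR` are filled too, so the outer words, and hence `F`, depend on `T`;
    -- they are the same for `τ₁` and `τ₂`.
    obtain ⟨F, hF⟩ := hrep (fillWord U τL) (fillWord U τR) α (fun i => b (g i)) ω (by omega)
      ⟨2, by rw [hω, mul_comm]⟩
    have h3 : ∀ (S : Finset (Fin x)) (i : Fin x),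
        3 ≤ if i ∈ S then (if g i ∈ T then 4 else 3) else 3 := by
      intro S i
      split_ifs <;> omega
    have hF₁ := hF _ (fun _ => 3) (h3 (j :: js).toFinset) fun _ => le_rfl
    have hF₂ := hF _ _ (h3 [j].toFinset) (h3 js.toFinset)
    rw [← hf, ← hf]
    simp only [hτ₁, hτ₂, map_mul, hfC, hconst]
    simp only [← hW, ← hw] at hF₁ hF₂
    simp only [← mul_assoc] at hF₁ hF₂ ⊢
    rw [hF₁, hF₂]
    congr 1
    funext i
    simp only [Pi.add_apply, List.mem_toFinset, List.mem_cons, List.not_mem_nil, or_false]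
    -- The exponent sums agree: for `i = j` the second exponent is `3` in both templates, and for
    -- the other indices the two exponents are exchanged.
    by_cases hij : i = j
    · simp [hij, hjs'.1]
    · simp [hij, add_comm]
  simp only [hexp] at h₁ h₂
  simp only [hword, hslots] at h₁
  -- The base equals `-ω`, so this common factor of both mixed differences can be cancelled.
  have hne : (((ω * 3 - 3 : ℕ) : ℤ) - (ω * 4 - 3 : ℕ)) ^ k ≠ 0 := by
    refine pow_ne_zero _ ?_
    omega
  have hmain := Nat.cast_injective (mul_left_cancel₀ hne (h₁.symm.trans h₂))
  have hiC : ∀ S, iterContext 𝓜.μ b (C S)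
      = partialForm 𝓜.μ (fun i => 𝓜.μ (α i)) (fun i => b (g i)) S :=
    iterContext_center 𝓜.μ α b g (by omega) hb
  have hic : ∀ v, iterContext 𝓜.μ b (const v) = .ctx (𝓜.μ v) := fun v => by simp [iterContext]
  have hee : (.ctx e : Multicontext A M) * .ctx e = .ctx e := by
    rw [Multicontext.ctx_mul_ctx, hidem.eq]
  have hμ₁ : 𝓜.μ (w ^ (ω - 1) * W (fun _ => 3) * w ^ ω) = e := by
    rw [map_mul, map_mul, hpow _ (by omega), hpow _ hω0, hval _ (fun _ => by omega), hidem.eq,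
      hidem.eq]
  have hi₁ : iterContext 𝓜.μ b τ₁ = iterContext 𝓜.μ b τL *
      (.ctx e * partialForm 𝓜.μ (fun i => 𝓜.μ (α i)) (fun i => b (g i)) (j :: js).toFinset *
        .ctx e) * iterContext 𝓜.μ b τR := by
    rw [hτ₁, map_mul, map_mul, map_mul, map_mul, hiC, hic, hic, hμ₁, hpow _ (by omega)]
  have hi₂ : iterContext 𝓜.μ b τ₂ = iterContext 𝓜.μ b τL *
      (.ctx e * partialForm 𝓜.μ (fun i => 𝓜.μ (α i)) (fun i => b (g i)) {j} * .ctx e) *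
      (.ctx e * partialForm 𝓜.μ (fun i => 𝓜.μ (α i)) (fun i => b (g i)) js.toFinset * .ctx e) *
      iterContext 𝓜.μ b τR := by
    have hj : [j].toFinset = {j} := rfl
    rw [hτ₂, map_mul, map_mul, map_mul, map_mul, map_mul, map_mul, hiC, hiC, hic, hic, hic,
      hpow _ (by omega), hpow _ (by omega), hpow _ hω0, hj]
    simp only [mul_assoc]
    rw [← mul_assoc (Multicontext.ctx e) (.ctx e), hee]
  rw [hi₁, hi₂] at hmain
  exact hmain

/-- Induction on `js`: each block split off joins the left context, which is why `τL` is arbitrary.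
The blocks appear in the order of the list, while the left-hand side depends only on its set of
elements. -/
theorem prod_partialForm (𝓜 : MarbleBimachine A M k) {f : FreeMonoid A → ℕ}
    (hf : 𝓜.Computes f) (hrep : IsRepetitive x f) {b : ι → FreeMonoid A}
    (hb : ∀ i, IsIdempotentElem (𝓜.μ (b i))) (α : Fin (x + 1) → FreeMonoid A) (g : Fin x → ι)
    {e : M} (he : e = iteratorValue 𝓜.μ (fun i => 𝓜.μ (α i)) fun i => b (g i))
    (hidem : IsIdempotentElem e) (τR : Template A ι) (js : List (Fin x)) (hne : js ≠ [])
    (hjs : js.Nodup) :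
    ∀ τL : Template A ι, (slots τL ++ js.map g ++ slots τR).Nodup →
    (slots τL ++ js.map g ++ slots τR).length = k →
    𝓜.prod (iterContext 𝓜.μ b τL *
        (.ctx e * partialForm 𝓜.μ (fun i => 𝓜.μ (α i)) (fun i => b (g i)) js.toFinset *
          .ctx e) * iterContext 𝓜.μ b τR)
      = 𝓜.prod (iterContext 𝓜.μ b τL * (js.map fun j =>
        .ctx e * partialForm 𝓜.μ (fun i => 𝓜.μ (α i)) (fun i => b (g i)) {j} * .ctx e).prod *
        iterContext 𝓜.μ b τR) := by
  induction js with
  | nil => exact absurd rfl hne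
  | cons j js ih =>
    intro τL hnd hk
    by_cases hne' : js = []
    · simp [hne']
    · obtain ⟨v, hv⟩ := 𝓜.μ_surj e
      -- The block split off must be written as a template to extend `τL`. Any word `v` of value `e`
      -- and exponent `1` suffice, since only the image under `iterContext` matters.
      set τ : Template A ι := const v * center α b g 1 [j].toFinset * const v with hτ
      have hs : slots τ = [g j] := by
        have h := slots_center_perm α b g 1 (List.nodup_singleton j)
        simp only [hτ, slots_mul, slots_const, List.nil_append, List.append_nil]
        exact List.perm_singleton.1 h
      have hi : iterContext 𝓜.μ b τ
          = .ctx e * partialForm 𝓜.μ (fun i => 𝓜.μ (α i)) (fun i => b (g i)) {j} * .ctx e := by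
        have hic : iterContext 𝓜.μ b (const v) = .ctx e := by simp [iterContext, hv]
        rw [hτ, map_mul, map_mul, iterContext_center 𝓜.μ α b g one_ne_zero hb, hic]
        rfl
      have hsl : slots (τL * τ) ++ js.map g ++ slots τR
          = slots τL ++ (j :: js).map g ++ slots τR := by
        simp [hs]
      have h := ih hne' (List.nodup_cons.1 hjs).2 (τL * τ) (by rwa [hsl]) (by rwa [hsl])
      rw [map_mul, hi] at h
      rw [prod_partialForm_cons 𝓜 hf hrep hb α g he hidem τL τR hjs hnd hk, h, List.map_cons,
        List.prod_cons]
      simp only [mul_assoc]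

end Template

/-! ### Permutability. -/

theorem mainTheorem2 {A : Type*} {M : Type*} [Finite A] [Monoid M] [Finite M] {k : ℕ}
    (hk : 1 ≤ k) (f : FreeMonoid A → ℕ) (hrep : IsRepetitive k f)
    (𝓜 : MarbleBimachine A M k) (hf : 𝓜.Computes f) (K : ℕ) :
    𝓜.IsPermutable K := by
  rintro l x r hlxr hx _ _ ⟨mL, uL, hL, rfl⟩ ⟨mR, uR, hR, rfl⟩ m u hu hidem σ
  obtain ⟨α, rfl⟩ : ∃ α : Fin (x + 1) → FreeMonoid A, m = fun i => 𝓜.μ (α i) :=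
    ⟨fun i => (𝓜.μ_surj (m i)).choose, funext fun i => (𝓜.μ_surj (m i)).choose_spec.symm⟩
  obtain ⟨αL, rfl⟩ : ∃ α : Fin (l + 1) → FreeMonoid A, mL = fun i => 𝓜.μ (α i) :=
    ⟨fun i => (𝓜.μ_surj (mL i)).choose, funext fun i => (𝓜.μ_surj (mL i)).choose_spec.symm⟩
  obtain ⟨αR, rfl⟩ : ∃ α : Fin (r + 1) → FreeMonoid A, mR = fun i => 𝓜.μ (α i) :=
    ⟨fun i => (𝓜.μ_surj (mR i)).choose, funext fun i => (𝓜.μ_surj (mR i)).choose_spec.symm⟩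
  -- The brackets of the outer iterators are slots as well, so that there are `l + x + r = k`
  -- distinct labels.
  let b : Fin l ⊕ Fin x ⊕ Fin r → FreeMonoid A := Sum.elim uL (Sum.elim u uR)
  have hb : ∀ i, IsIdempotentElem (𝓜.μ (b i)) := by
    rintro (i | i | i)
    exacts [(hL i).1, (hu i).1, (hR i).1]
  let gL : Fin l → Fin l ⊕ Fin x ⊕ Fin r := Sum.inl
  let g : Fin x → Fin l ⊕ Fin x ⊕ Fin r := fun i => Sum.inr (Sum.inl i)
  let gR : Fin r → Fin l ⊕ Fin x ⊕ Fin r := fun i => Sum.inr (Sum.inr i)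
  let τL := Template.center αL b gL 1 Finset.univ
  let τR := Template.center αR b gR 1 Finset.univ
  have hiL : Template.iterContext 𝓜.μ b τL = iteratorForm 𝓜.μ (fun i => 𝓜.μ (αL i)) uL := by
    rw [Template.iterContext_center 𝓜.μ αL b gL one_ne_zero hb, Template.partialForm_univ]
    rfl
  have hiR : Template.iterContext 𝓜.μ b τR = iteratorForm 𝓜.μ (fun i => 𝓜.μ (αR i)) uR := by
    rw [Template.iterContext_center 𝓜.μ αR b gR one_ne_zero hb, Template.partialForm_univ]
    rfl
  have hsL : τL.slots = (List.finRange l).map gL := by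
    rw [Template.slots_center]
    simp
  have hsR : τR.slots = (List.finRange r).map gR := by
    rw [Template.slots_center]
    simp
  have hσ : (List.ofFn σ).Nodup := List.nodup_ofFn.2 σ.injective
  have hσu : (List.ofFn σ).toFinset = Finset.univ := by
    ext i
    simpa [List.mem_ofFn] using σ.surjective i
  -- Listing all the indices in the order of `σ` leaves the initial block unchanged and prescribes
  -- the final order.
  have h := Template.prod_partialForm 𝓜 hf (hrep.of_le (by omega : x ≤ k)) hb α g rfl hidem τR
    (List.ofFn σ) (by
      intro h
      have := congrArg List.length h
      simp only [List.length_ofFn, List.length_nil] at this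
      omega) hσ τL
    (by
      rw [hsL, hsR, List.nodup_append', List.nodup_append']
      refine ⟨⟨(List.nodup_finRange l).map Sum.inl_injective,
        hσ.map (Sum.inr_injective.comp Sum.inl_injective), ?_⟩,
        (List.nodup_finRange r).map (Sum.inr_injective.comp Sum.inr_injective), ?_⟩
      · intro i hi hi'
        obtain ⟨_, _, rfl⟩ := List.mem_map.1 hi
        obtain ⟨_, _, h⟩ := List.mem_map.1 hi'
        cases h
      · intro i hi hi'
        obtain ⟨_, _, rfl⟩ := List.mem_map.1 hi'
        rcases List.mem_append.1 hi with hi | hi <;>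
        · obtain ⟨_, _, h⟩ := List.mem_map.1 hi
          cases h)
    (by
      rw [hsL, hsR]
      simpa [add_assoc] using hlxr)
  have hu' : (fun i => b (g i)) = u := rfl
  rw [hσu, hiL, hiR, hu', Template.partialForm_univ, List.map_ofFn] at h
  have hfun : ((fun j => Multicontext.ctx (iteratorValue 𝓜.μ (fun i => 𝓜.μ (α i)) u) *
      Template.partialForm 𝓜.μ (fun i => 𝓜.μ (α i)) u {j} *
      .ctx (iteratorValue 𝓜.μ (fun i => 𝓜.μ (α i)) u)) ∘ σ)
      = fun i => .ctx (iteratorLeft 𝓜.μ (fun i => 𝓜.μ (α i)) u (σ i)) * .bracket (u (σ i)) *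
        .ctx (iteratorRight 𝓜.μ (fun i => 𝓜.μ (α i)) u (σ i)) :=
    funext fun i => Template.partialForm_singleton 𝓜.μ _ u (σ i)
  rw [hfun] at h
  simpa only [mul_assoc] using h
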